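/- Let $K$ be an algebraically closed field, let $P\subset\mathbb{R}^m$ be an $m$-dimensional polytope whose vertices lie in $\mathbb{Z}^m$, let $S_P\subset\mathbb{Z}^m\times\mathbb{Z}$ be the semigroup generated by $(P\cap\mathbb{Z}^m)\times\{1\}$, and let $X_P=\operatorname{Proj}K[S_P]$, embedded in the projective space $\mathbb{P}$ over $K$ with homogeneous coordinates $x_u$, $u\in P\cap\mathbb{Z}^m$, via $x_u\mapsto\chi^{(u,1)}$. The torus $T=\operatorname{Spec}K[\mathbb{Z}^m]$ acts on $\mathbb{P}$ by $t\cdot(x_u)_u=(t^u x_u)_u$; this action preserves $X_P$ and hence induces an action on the Fano scheme $\mathbf{F}_k(X_P)$, the fine moduli space of $k$-planes of $\mathbb{P}$ contained in $X_P$ ($k\ge 0$). A primitive $k$-simplex is the convex hull of $k+1$ affinely independent points of $\mathbb{Z}^m$ that contains no other points of $\mathbb{Z}^m$. For a nonempty face $Q$ of $P$ (with $Q=P$ allowed) let $X_Q\subset X_P$ be the closure of the corresponding torus orbit, that is, of the $T$-orbit of the point of $\mathbb{P}$ with $x_u=1$ for $u\in Q$ and $x_u=0$ for $u\notin Q$.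 (1) For every $k\geq 0$, the faces $Q$ of $P$ that are primitive $k$-simplices are in bijection with the $T$-fixed $K$-points of $\mathbf{F}_k(X_P)$; the bijection sends $Q$ to the $k$-plane $X_Q$. (2) For every nonempty face $Q$ of $P$, the orbit closure $X_Q$ is a linear subspace of $\mathbb{P}$ if and only if $Q$ is a primitive $d$-simplex for some $d\ge 0$; more precisely, for every $d\geq 0$, $X_Q$ is a $d$-dimensional linear subspace of $\mathbb{P}$ if and only if $Q$ is a primitive $d$-simplex. -/

import Mathlib

open CategoryTheory

universe u

namespace ToricFano

/-! ### Projective space, linear subspaces and the Fano scheme -/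

section Fano

variable {K : Type u} [Field K] {ι : Type}

/-- The base change of a submodule `M ⊆ R^ι` along `φ : R → S`: the `S`-submodule of `S^ι`
spanned by the image of `M`. -/
def baseChange {R S : Type u} [CommRing R] [CommRing S] (φ : R →+* S)
    (M : Submodule R (ι → R)) : Submodule S (ι → S) :=
  Submodule.span S ((fun v i => φ (v i)) '' (M : Set (ι → R)))

/-- An `R`-valued point of the Fano scheme `F_k(X)` of the closed subscheme `X = V(I)` of the
projective space over `K` with homogeneous coordinates `x_i`, `i ∈ ι` (`I` a homogeneous ideal):
a family over `Spec R` of `k`-planes contained in `X`, i.e. a direct summand `M` of `R^ι` of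
constant rank `k + 1` all of whose points, over all `R`-algebras `S`, are zeros of `I`. -/
@[ext]
structure FanoPoint (I : Ideal (MvPolynomial ι K)) (k : ℕ) (R : Type u) [CommRing R]
    [Algebra K R] where
  toSubmodule : Submodule R (ι → R)
  isComplemented : IsComplemented toSubmodule
  rank_eq : ∀ p : PrimeSpectrum R, Module.rankAtStalk toSubmodule p = k + 1
  vanishing : ∀ (S : Type u) [CommRing S] [Algebra K S] (φ : R →ₐ[K] S),
    ∀ v ∈ baseChange (φ : R →+* S) toSubmodule, ∀ f ∈ I, MvPolynomial.aeval v f = 0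

theorem baseChange_id {R : Type u} [CommRing R] (M : Submodule R (ι → R)) :
    baseChange (RingHom.id R) M = M := by
  simp [baseChange]

theorem baseChange_comp {R S S' : Type u} [CommRing R] [CommRing S] [CommRing S']
    (φ : R →+* S) (ψ : S →+* S') (M : Submodule R (ι → R)) :
    baseChange ψ (baseChange φ M) = baseChange (ψ.comp φ) M := by
  apply le_antisymm
  · refine Submodule.span_le.2 ?_
    rintro _ ⟨v, hv, rfl⟩
    simp only [SetLike.mem_coe] at hv ⊢
    induction hv using Submodule.span_induction with
    | mem x hx =>
      obtain ⟨w, hw, rfl⟩ := hx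
      exact Submodule.subset_span ⟨w, hw, rfl⟩
    | zero =>
      convert Submodule.zero_mem _ using 1
      ext i; simp
    | add x y _ _ hx hy =>
      convert Submodule.add_mem _ hx hy using 1
      ext i; simp
    | smul a x _ hx =>
      convert Submodule.smul_mem _ (ψ a) hx using 1
      ext i; simp
  · refine Submodule.span_le.2 ?_
    rintro _ ⟨v, hv, rfl⟩
    exact Submodule.subset_span ⟨fun i => φ (v i), Submodule.subset_span ⟨v, hv, rfl⟩, rfl⟩

open TensorProduct in
/-- A direct summand stays a direct summand under base change, and the base change is the
tensor product. -/
theorem baseChange_aux [Finite ι] {R S : Type u} [CommRing R] [CommRing S] [Algebra R S]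
    (M : Submodule R (ι → R)) (hM : IsComplemented M) :
    IsComplemented (baseChange (algebraMap R S) M) ∧
      Nonempty (S ⊗[R] M ≃ₗ[S] baseChange (algebraMap R S) M) := by
  classical
  have := Fintype.ofFinite ι
  obtain ⟨N, hN⟩ := hM
  let r : (ι → R) →ₗ[R] M := M.projectionOnto N hN
  have hr : r ∘ₗ M.subtype = LinearMap.id := by
    ext x : 1
    exact Submodule.projectionOnto_apply_left hN x
  let e : S ⊗[R] (ι → R) ≃ₗ[S] (ι → S) := TensorProduct.piScalarRight R S S ι
  have he : ∀ (a : S) (v : ι → R), e (a ⊗ₜ v) = fun i => algebraMap R S (v i) * a := by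
    intro a v
    ext i
    simp [e, TensorProduct.piScalarRight_apply, TensorProduct.piScalarRightHom_tmul,
      Algebra.smul_def]
  let j : S ⊗[R] M →ₗ[S] (ι → S) := e.toLinearMap ∘ₗ M.subtype.baseChange S
  let r' : (ι → S) →ₗ[S] S ⊗[R] M := r.baseChange S ∘ₗ e.symm.toLinearMap
  have hrj : ∀ x, r' (j x) = x := by
    intro x
    have h1 : r' (j x) = (r.baseChange S ∘ₗ M.subtype.baseChange S) x := by simp [r', j]
    rw [h1, ← LinearMap.baseChange_comp, hr]
    simp
  have hj : Function.Injective j := Function.LeftInverse.injective hrj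
  have hrange : LinearMap.range j = baseChange (algebraMap R S) M := by
    apply le_antisymm
    · rintro _ ⟨x, rfl⟩
      induction x using TensorProduct.induction_on with
      | zero => simp
      | tmul a v =>
        have h2 : j (a ⊗ₜ v) = a • fun i => algebraMap R S ((v : ι → R) i) := by
          simp only [j, LinearMap.comp_apply, LinearMap.baseChange_tmul, LinearEquiv.coe_coe, he]
          ext i
          simp [mul_comm]
        rw [h2]
        exact Submodule.smul_mem _ _ (Submodule.subset_span ⟨v, v.2, rfl⟩)
      | add x y hx hy => rw [map_add]; exact Submodule.add_mem _ hx hy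
    · refine Submodule.span_le.2 ?_
      rintro _ ⟨v, hv, rfl⟩
      refine ⟨1 ⊗ₜ ⟨v, hv⟩, ?_⟩
      simp [j, he]
  rw [← hrange]
  refine ⟨⟨LinearMap.ker (j.rangeRestrict ∘ₗ r'), LinearMap.isCompl_of_proj ?_⟩,
    ⟨LinearEquiv.ofInjective j hj⟩⟩
  rintro ⟨_, x, rfl⟩
  ext1
  simp [hrj]

/-- Functoriality of the points of the Fano scheme: pulling back families of `k`-planes. -/
def FanoPoint.map [Finite ι] {I : Ideal (MvPolynomial ι K)} {k : ℕ} {R S : Type u} [CommRing R]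
    [CommRing S] [Algebra K R] [Algebra K S] (φ : R →ₐ[K] S) (x : FanoPoint I k R) :
    FanoPoint I k S where
  toSubmodule := baseChange (φ : R →+* S) x.toSubmodule
  isComplemented := by
    let : Algebra R S := (φ : R →+* S).toAlgebra
    exact (baseChange_aux (S := S) x.toSubmodule x.isComplemented).1
  rank_eq p := by
    let : Algebra R S := (φ : R →+* S).toAlgebra
    obtain ⟨e⟩ := (baseChange_aux (S := S) x.toSubmodule x.isComplemented).2
    have : Module.Finite R x.toSubmodule := by
      obtain ⟨N, hN⟩ := x.isComplemented
      exact Module.Finite.of_surjective _ (Submodule.projectionOnto_surjective hN)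
    have : Module.Projective R x.toSubmodule := by
      obtain ⟨N, hN⟩ := x.isComplemented
      refine Module.Projective.of_split x.toSubmodule.subtype
        (x.toSubmodule.projectionOnto N hN) ?_
      ext1 y
      exact Submodule.projectionOnto_apply_left hN y
    have h := congrFun (Module.rankAtStalk_eq_of_equiv e) p
    rw [Module.rankAtStalk_baseChange, x.rank_eq] at h
    exact h.symm
  vanishing S' _ _ ψ v hv f hf := by
    rw [baseChange_comp] at hv
    exact x.vanishing S' (ψ.comp φ) v hv f hf

theorem FanoPoint.map_id [Finite ι] {I : Ideal (MvPolynomial ι K)} {k : ℕ} {R : Type u}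
    [CommRing R] [Algebra K R] (x : FanoPoint I k R) : x.map (AlgHom.id K R) = x :=
  FanoPoint.ext (baseChange_id x.toSubmodule)

theorem FanoPoint.map_comp [Finite ι] {I : Ideal (MvPolynomial ι K)} {k : ℕ} {R S S' : Type u}
    [CommRing R] [CommRing S] [CommRing S'] [Algebra K R] [Algebra K S] [Algebra K S']
    (φ : R →ₐ[K] S) (ψ : S →ₐ[K] S') (x : FanoPoint I k R) :
    x.map (ψ.comp φ) = (x.map φ).map ψ :=
  FanoPoint.ext (baseChange_comp (φ : R →+* S) (ψ : S →+* S') x.toSubmodule).symm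

/-- The Fano scheme `F_k(X)` of `k`-planes in `X = V(I) ⊆ ℙ(K^ι)`, the fine moduli space of
`k`-planes contained in `X`, as a functor of points on `K`-algebras. -/
def fanoScheme [Finite ι] (I : Ideal (MvPolynomial ι K)) (k : ℕ) :
    CommAlgCat.{u} K ⥤ Type u where
  obj R := FanoPoint I k R
  map φ := ↾(FanoPoint.map φ.hom)
  map_id R := by
    refine ConcreteCategory.hom_ext _ _ fun x => ?_
    exact FanoPoint.map_id x
  map_comp φ ψ := by
    refine ConcreteCategory.hom_ext _ _ fun x => ?_
    exact FanoPoint.map_comp φ.hom ψ.hom x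

/-- The set of points of `ℙ(K^ι)` lying on the linear subspace given by `W ⊆ K^ι`. -/
def linearSubspace (W : Submodule K (ι → K)) : Set (Projectivization K (ι → K)) :=
  {p | p.submodule ≤ W}

/-- The Zariski closure of a set of points of `ℙ(K^ι)`: the common zeros of all forms that
vanish on the set. -/
def zariskiClosure (Z : Set (Projectivization K (ι → K))) :
    Set (Projectivization K (ι → K)) :=
  {p | ∀ (d : ℕ) (f : MvPolynomial ι K), f.IsHomogeneous d →
    (∀ q ∈ Z, MvPolynomial.eval q.rep f = 0) → MvPolynomial.eval p.rep f = 0}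

end Fano

/-! ### Lattice polytopes -/

section Polytope

variable {m : ℕ}

/-- A lattice point of `ℤ^m` viewed in `ℝ^m`. -/
def toReal (u : Fin m → ℤ) : Fin m → ℝ := fun i => (u i : ℝ)

variable (m) in
/-- An `m`-dimensional polytope in `ℝ^m` whose vertices are lattice points. -/
structure LatticePolytope where
  carrier : Set (Fin m → ℝ)
  exists_eq_convexHull : ∃ V : Finset (Fin m → ℤ),
    carrier = convexHull ℝ (toReal '' (V : Set (Fin m → ℤ)))
  affineSpan_eq_top : affineSpan ℝ carrier = ⊤

/-- The set of lattice points `P ∩ ℤ^m`. -/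
abbrev LatticePolytope.latticePoints (P : LatticePolytope m) : Set (Fin m → ℤ) :=
  {u | toReal u ∈ P.carrier}

instance (P : LatticePolytope m) : Finite P.latticePoints := by
  obtain ⟨V, hV⟩ := P.exists_eq_convexHull
  have hb : Bornology.IsBounded P.carrier := by
    rw [hV, isBounded_convexHull]
    exact (V.finite_toSet.image _).isBounded
  obtain ⟨C, hC⟩ := hb.exists_norm_le
  have hfin : (Set.Icc (fun _ => -⌈C⌉ : Fin m → ℤ) (fun _ => ⌈C⌉)).Finite := Set.finite_Icc _ _
  refine (hfin.subset fun u hu => ?_).to_subtype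
  have h : ∀ i, |(u i : ℝ)| ≤ C := fun i => (norm_le_pi_norm (toReal u) i).trans (hC _ hu)
  refine ⟨fun i => ?_, fun i => ?_⟩
  · have := (abs_le.1 (h i)).1
    have h2 := Int.le_ceil C
    have : (-⌈C⌉ : ℝ) ≤ u i := by linarith
    exact_mod_cast this
  · have := (abs_le.1 (h i)).2
    have h2 := Int.le_ceil C
    have : (u i : ℝ) ≤ ⌈C⌉ := by linarith
    exact_mod_cast this

/-- `Q` is a (nonempty) face of the polytope `P`: the set of points of `P` where some linear
functional is maximal (so `P` itself is a face). -/
def IsFace (P : LatticePolytope m) (Q : Set (Fin m → ℝ)) : Prop :=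
  IsExposed ℝ P.carrier Q ∧ Q.Nonempty

/-- `Q` is a primitive `k`-simplex: the convex hull of `k + 1` affinely independent lattice points
that contains no other lattice points. -/
def IsPrimitiveSimplex (k : ℕ) (Q : Set (Fin m → ℝ)) : Prop :=
  ∃ v : Fin (k + 1) → (Fin m → ℤ),
    AffineIndependent ℝ (fun i => toReal (v i)) ∧
    Q = convexHull ℝ (Set.range fun i => toReal (v i)) ∧
    ∀ u : Fin m → ℤ, toReal u ∈ Q → u ∈ Set.range v

end Polytope

/-! ### The projective toric variety of a lattice polytope and its torus -/

section Toric

variable {m : ℕ} (K : Type u) [Field K] (P : LatticePolytope m)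

/-- The subsemigroup `S_P` of `ℤ^m × ℤ` generated by `(P ∩ ℤ^m) × {1}`. -/
def semigroup : AddSubmonoid ((Fin m → ℤ) × ℤ) :=
  AddSubmonoid.closure ((fun u => (u, 1)) '' P.latticePoints)

/-- The generator `(u, 1)` of `S_P`, for `u ∈ P ∩ ℤ^m`. -/
def semigroupGen (u : P.latticePoints) : semigroup P :=
  ⟨((u : Fin m → ℤ), 1), AddSubmonoid.subset_closure ⟨u, u.2, rfl⟩⟩

/-- The surjection `K[x_u | u ∈ P ∩ ℤ^m] → K[S_P]`, `x_u ↦ χ^(u,1)`. -/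
noncomputable def toricHom :
    MvPolynomial P.latticePoints K →ₐ[K] AddMonoidAlgebra K (semigroup P) :=
  MvPolynomial.aeval fun u => AddMonoidAlgebra.single (semigroupGen P u) 1

/-- The homogeneous ideal `I_P` of `X_P = Proj K[S_P]` in the projective space with coordinates
`x_u`, `u ∈ P ∩ ℤ^m`: the kernel of `K[x_u] → K[S_P]`. -/
noncomputable def toricIdeal : Ideal (MvPolynomial P.latticePoints K) :=
  RingHom.ker (toricHom K P)

variable (m) in
/-- The `R`-points `(Rˣ)^m` of the torus `T = Spec K[ℤ^m]`. -/
abbrev Torus (R : Type u) [CommRing R] : Type u := Fin m → Rˣ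

/-- The value `t^u` of the character `u ∈ ℤ^m` at `t ∈ T(R)`. -/
def character {R : Type u} [CommRing R] (u : Fin m → ℤ) : Torus m R →* Rˣ where
  toFun t := ∏ i, t i ^ u i
  map_one' := by simp
  map_mul' s t := by simp [mul_zpow, Finset.prod_mul_distrib]

/-- The action of `t ∈ T(R)` on the homogeneous coordinates: `x_u` is scaled by `t^u`. -/
def torusEquiv {R : Type u} [CommRing R] (t : Torus m R) :
    (P.latticePoints → R) ≃ₗ[R] (P.latticePoints → R) :=
  LinearEquiv.piCongrRight fun u => LinearEquiv.smulOfUnit (character (u : Fin m → ℤ) t)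

variable {K P}

theorem torusEquiv_apply {R : Type u} [CommRing R] (t : Torus m R) (v : P.latticePoints → R)
    (u : P.latticePoints) :
    torusEquiv P t v u = (character (u : Fin m → ℤ) t : R) * v u := rfl

theorem character_add {R : Type u} [CommRing R] (u v : Fin m → ℤ) (t : Torus m R) :
    character (u + v) t = character u t * character v t := by
  simp [character, zpow_add, Finset.prod_mul_distrib]

theorem character_zero {R : Type u} [CommRing R] (t : Torus m R) :
    character (0 : Fin m → ℤ) t = 1 := by
  simp [character]

theorem toricHom_surjective : Function.Surjective (toricHom K P) := by
  rw [← AlgHom.range_eq_top, eq_top_iff]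
  have key : ∀ s (hs : s ∈ semigroup P),
      AddMonoidAlgebra.single (⟨s, hs⟩ : semigroup P) (1 : K) ∈ (toricHom K P).range := by
    intro s hs
    induction hs using AddSubmonoid.closure_induction with
    | mem x hx =>
      obtain ⟨u, hu, rfl⟩ := hx
      exact ⟨MvPolynomial.X ⟨u, hu⟩, by simp [toricHom, semigroupGen]⟩
    | zero => exact Subalgebra.one_mem _
    | add x y hx hy h1 h2 =>
      have := Subalgebra.mul_mem _ h1 h2
      rw [AddMonoidAlgebra.single_mul_single, one_mul] at this
      exact this
  intro f _
  induction f using AddMonoidAlgebra.induction_on with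
  | of s => exact key _ (Multiplicative.toAdd s).2
  | add f g hf hg => exact Subalgebra.add_mem _ (hf trivial) (hg trivial)
  | smul r f hf => exact Subalgebra.smul_mem _ (hf trivial) r

/-- The torus preserves `X_P`. -/
theorem aeval_torusEquiv {R : Type u} [CommRing R] [Algebra K R] (t : Torus m R)
    (v : P.latticePoints → R) (hv : ∀ f ∈ toricIdeal K P, MvPolynomial.aeval v f = 0) :
    ∀ f ∈ toricIdeal K P, MvPolynomial.aeval (torusEquiv P t v) f = 0 := by
  let ψ : AddMonoidAlgebra K (semigroup P) →ₐ[K] R :=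
    AlgHom.liftOfSurjective (toricHom K P) toricHom_surjective (MvPolynomial.aeval v) hv
  have hψ : ∀ u, ψ (AddMonoidAlgebra.single (semigroupGen P u) 1) = v u := by
    intro u
    have : ψ (toricHom K P (MvPolynomial.X u)) = MvPolynomial.aeval v (MvPolynomial.X u) :=
      AlgHom.liftOfSurjective_apply _ _ _ _ _
    simpa [toricHom] using this
  let χ : Multiplicative (semigroup P) →* R :=
    { toFun := fun s => (character (s.toAdd : (Fin m → ℤ) × ℤ).1 t : R) *
        ψ (AddMonoidAlgebra.single s.toAdd 1)
      map_one' := by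
        have : ψ (AddMonoidAlgebra.single 0 1) = 1 := map_one ψ
        simp [character_zero, this]
      map_mul' := by
        intro a b
        have : (AddMonoidAlgebra.single (a.toAdd + b.toAdd) (1 : K)) =
            AddMonoidAlgebra.single a.toAdd 1 * AddMonoidAlgebra.single b.toAdd 1 := by
          rw [AddMonoidAlgebra.single_mul_single, one_mul]
        simp only [toAdd_mul, this, map_mul, AddSubmonoid.coe_add, Prod.fst_add, character_add,
          Units.val_mul]
        ring }
  have hχ : (AddMonoidAlgebra.lift K R (semigroup P) χ).comp (toricHom K P) =
      MvPolynomial.aeval (torusEquiv P t v) := by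
    ext u
    simp [toricHom, χ, ← hψ, torusEquiv_apply, semigroupGen]
  intro f hf
  rw [← hχ, AlgHom.comp_apply, show toricHom K P f = 0 from hf, map_zero]

theorem baseChange_torusEquiv {R S : Type u} [CommRing R] [CommRing S] (φ : R →+* S)
    (t : Torus m R) (M : Submodule R (P.latticePoints → R)) :
    baseChange φ (M.map (torusEquiv P t).toLinearMap) =
      (baseChange φ M).map (torusEquiv P fun i => Units.map (φ : R →* S) (t i)).toLinearMap := by
  rw [baseChange, baseChange, Submodule.map_span]
  congr 1
  simp only [Submodule.map_coe, Set.image_image]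
  refine Set.image_congr fun v _ => ?_
  ext u
  have h : ((character (u : Fin m → ℤ) fun i => Units.map (φ : R →* S) (t i)) : Sˣ) =
      Units.map (φ : R →* S) (character (u : Fin m → ℤ) t) := by
    simp [character, map_prod, map_zpow]
  simp [torusEquiv_apply, h]

/-- The action of `T(R)` on the `R`-points of `F_k(X_P)`: the `k`-plane `L` is moved to `t · L`. -/
def torusAct {k : ℕ} {R : Type u} [CommRing R] [Algebra K R] (t : Torus m R)
    (x : FanoPoint (toricIdeal K P) k R) : FanoPoint (toricIdeal K P) k R where
  toSubmodule := x.toSubmodule.map (torusEquiv P t).toLinearMap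
  isComplemented := by
    obtain ⟨N, hN⟩ := x.isComplemented
    exact ⟨_, hN.map (Submodule.orderIsoMapComap (torusEquiv P t))⟩
  rank_eq p := by
    rw [← x.rank_eq p]
    exact congrFun (Module.rankAtStalk_eq_of_equiv ((torusEquiv P t).submoduleMap _)).symm p
  vanishing S _ _ φ v hv := by
    rw [baseChange_torusEquiv] at hv
    obtain ⟨w, hw, rfl⟩ := hv
    exact aeval_torusEquiv _ w fun f hf => x.vanishing S φ w hw f hf

/-- The actions of the groups `T(R)` are compatible with change of `R`. -/
theorem map_torusAct {k : ℕ} {R S : Type u} [CommRing R] [CommRing S] [Algebra K R] [Algebra K S]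
    (φ : R →ₐ[K] S) (t : Torus m R) (x : FanoPoint (toricIdeal K P) k R) :
    (torusAct t x).map φ =
      torusAct (fun i => Units.map ((φ : R →+* S) : R →* S) (t i)) (x.map φ) :=
  FanoPoint.ext (baseChange_torusEquiv (φ : R →+* S) t x.toSubmodule)

variable (K P)

/-- The torus fixed points of the Fano scheme `F_k(X_P)`: the `K`-points that are fixed by the
action of the group scheme `T`, i.e. by all `R`-points of `T`, for all `K`-algebras `R`. -/
def fixedPoints (k : ℕ) : Set ((fanoScheme (toricIdeal K P) k).obj (CommAlgCat.of K K)) :=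
  {x | ∀ (R : Type u) [CommRing R] [Algebra K R] (t : Torus m R),
    torusAct t (FanoPoint.map (Algebra.ofId K R) x) = FanoPoint.map (Algebra.ofId K R) x}

open Classical in
/-- The vector with coordinates `1` at the lattice points of `Q` and `0` elsewhere; for a face `Q`
of `P`, it represents a point of `X_P`. -/
noncomputable def facePoint (Q : Set (Fin m → ℝ)) : P.latticePoints → K :=
  fun u => if toReal (u : Fin m → ℤ) ∈ Q then 1 else 0

/-- The torus orbit in `X_P` corresponding to the face `Q` of `P`. -/
def faceOrbit (Q : Set (Fin m → ℝ)) : Set (Projectivization K (P.latticePoints → K)) :=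
  {p | ∃ t : Torus m K, p.submodule = Submodule.span K {torusEquiv P t (facePoint K P Q)}}

/-- The closure `X_Q` of the torus orbit corresponding to the face `Q`. -/
def faceVariety (Q : Set (Fin m → ℝ)) : Set (Projectivization K (P.latticePoints → K)) :=
  zariskiClosure (faceOrbit K P Q)

end Toric

end ToricFano

/-! The problem reduces to coordinate subspaces. As `K` is infinite, distinct lattice points give
distinct characters of `T`, and distinct characters are linearly independent. Hence a
torus-invariant subspace is spanned by the coordinate vectors of some set `A` of lattice points
(`eq_coordinateSubspace_of_torusEquiv_mem`).

A vector is a zero of the toric ideal exactly when monomials of equal degree in `S_P` agree on it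
(`isToricPoint_iff`). Suppose this holds for all vectors supported on `A`. A real affine relation
among lattice points can be made integral without changing signs (`exists_int_sign_eq`), and its
positive and negative parts are then two monomials of equal degree. A relation within `A` would give
distinct monomials in the variables from `A`, so `A` is affinely independent
(`affineIndependent_of_isToricPoint`). If the affine span of `A` met the hull of the remaining
lattice points, a monomial supported on `A` would have the degree of one that is not. So the two are
disjoint, and a separating functional exhibits `A` as the lattice points of a face
(`exists_isFace_of_isToricPoint`). Conversely, on an affinely independent face the degree determines
the monomial, so every vector supported there is toric, over any ring (`IsFace.isToricPoint`).

For orbit closures, `X_Q` lies in the coordinate subspace of `Q`, and its orbit spans that subspace;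
so a linear `X_Q` equals it, and the argument above applies. If `Q` is affinely independent, the
monomials of a given degree supported on `Q` restrict to distinct characters on the orbit, so a form
vanishing on the orbit vanishes on the whole subspace (`linearSubspace_subset_faceVariety`). -/

namespace ToricFano

/-! ### Real relations between integer vectors -/

section Rational

variable {ι : Type*} [Fintype ι]

/-- Finitely many real numbers can be replaced by rational numbers with the same signs that
satisfy the same rational linear relations. -/
theorem exists_rat_sign_eq (c : ι → ℝ) : ∃ d : ι → ℚ,
    (∀ i, SignType.sign (d i) = SignType.sign (c i)) ∧
      ∀ r : ι → ℚ, ∑ i, (r i : ℝ) * c i = 0 → ∑ i, r i * d i = 0 := by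
  classical
  let E : Submodule ℚ ℝ := Submodule.span ℚ (Set.range c)
  have : FiniteDimensional ℚ E := FiniteDimensional.span_of_finite ℚ (Set.finite_range c)
  let b := Module.finBasis ℚ E
  let c' : ι → E := fun i => ⟨c i, Submodule.subset_span ⟨i, rfl⟩⟩
  let F : ι → (Fin (Module.finrank ℚ E) → ℝ) → ℝ := fun i x => ∑ j, (b.repr (c' i) j : ℝ) * x j
  have hF : ∀ i, Continuous (F i) := fun i => by fun_prop
  have hb : ∀ i, F i (fun j => (b j : ℝ)) = c i := by
    intro i
    have h := congrArg (Submodule.subtype E) (b.sum_repr (c' i))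
    simpa only [F, map_sum, map_smul, Submodule.subtype_apply, Rat.smul_def] using h
  -- The coordinates of `c i` in the ℚ-basis `b` are kept, while the basis is moved to a nearby
  -- rational point `y`. Rational relations survive because `φ` is ℚ-linear; signs survive because
  -- the nonzero ones are an open condition.
  let U : Set (Fin (Module.finrank ℚ E) → ℝ) := ⋂ i, {x | c i ≠ 0 → 0 < F i x * c i}
  have hU : IsOpen U := by
    refine isOpen_iInter_of_finite fun i => ?_
    by_cases hi : c i = 0
    · simp [hi]
    · simpa [hi] using isOpen_lt continuous_const ((hF i).mul continuous_const)
  have hbU : (fun j => (b j : ℝ)) ∈ U := by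
    refine Set.mem_iInter.2 fun i hi => ?_
    rw [hb]
    exact mul_self_pos.2 hi
  obtain ⟨y, hy⟩ := (DenseRange.piMap fun _ : Fin (Module.finrank ℚ E) =>
    Rat.denseRange_cast (𝕜 := ℝ)).exists_mem_open hU ⟨_, hbU⟩
  let φ : E →ₗ[ℚ] ℚ := b.constr ℚ y
  have hφ : ∀ i, ((φ (c' i) : ℚ) : ℝ) = F i (Pi.map (fun _ => Rat.cast) y) := by
    intro i
    simp [φ, F, Module.Basis.constr_apply_fintype]
  refine ⟨fun i => φ (c' i), fun i => ?_, fun r hr => ?_⟩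
  · by_cases hi : c i = 0
    · have : c' i = 0 := Subtype.ext hi
      simp [this, hi]
    · have h : 0 < ((φ (c' i) : ℚ) : ℝ) * c i := by
        rw [hφ]
        exact Set.mem_iInter.1 hy i hi
      rcases lt_or_gt_of_ne hi with h' | h'
      · have h2 : ((φ (c' i) : ℚ) : ℝ) < 0 := by
          by_contra h3
          exact absurd h (not_lt.2 (mul_nonpos_of_nonneg_of_nonpos (not_lt.1 h3) h'.le))
        rw [sign_neg h', sign_neg (by exact_mod_cast h2)]
      · have h2 : 0 < ((φ (c' i) : ℚ) : ℝ) := pos_of_mul_pos_left h h'.le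
        rw [sign_pos h', sign_pos (by exact_mod_cast h2)]
  · have h : ∑ i, r i • c' i = 0 := by
      apply Subtype.ext
      simpa [c', Rat.smul_def] using hr
    simpa using congrArg φ h

/-- Finitely many real numbers can be replaced by integers with the same signs that satisfy the
same integral linear relations. -/
theorem exists_int_sign_eq (c : ι → ℝ) : ∃ n : ι → ℤ,
    (∀ i, SignType.sign (n i) = SignType.sign (c i)) ∧
      ∀ r : ι → ℤ, ∑ i, (r i : ℝ) * c i = 0 → ∑ i, r i * n i = 0 := by
  obtain ⟨d, hd, hr⟩ := exists_rat_sign_eq c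
  have hdvd : ∀ i, ∃ k, ∏ j, (d j).den = (d i).den * k := fun i =>
    Finset.dvd_prod_of_mem (fun j => (d j).den) (Finset.mem_univ i)
  choose k hk using hdvd
  have hN : 0 < ∏ j, (d j).den := Finset.prod_pos fun j _ => (d j).den_pos
  have hn : ∀ i, (((d i).num * k i : ℤ) : ℚ) = d i * (∏ j, (d j).den : ℕ) := by
    intro i
    rw [hk i]
    push_cast
    rw [← mul_assoc, Rat.mul_den_eq_num]
  refine ⟨fun i => (d i).num * k i, fun i => ?_, fun r h => ?_⟩
  · have hk' : 0 < k i := Nat.pos_of_ne_zero fun h0 => by simp [hk i, h0] at hN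
    rw [← hd i, sign_mul, sign_pos (show (0 : ℤ) < k i by exact_mod_cast hk'), mul_one]
    rcases lt_trichotomy (d i) 0 with h | h | h
    · rw [sign_neg h, sign_neg (Rat.num_neg.2 h)]
    · simp [h]
    · rw [sign_pos h, sign_pos (Rat.num_pos.2 h)]
  · have h2 := hr (fun i => r i) (by simpa using h)
    have h3 : ((∑ i, r i * ((d i).num * k i) : ℤ) : ℚ) = 0 := by
      rw [Int.cast_sum]
      calc ∑ i, ((r i * ((d i).num * k i) : ℤ) : ℚ)
          = ∑ i, (r i * d i) * (∏ j, (d j).den : ℕ) := by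
            refine Finset.sum_congr rfl fun i _ => ?_
            rw [Int.cast_mul, hn, mul_assoc]
        _ = 0 := by rw [← Finset.sum_mul, h2, zero_mul]
    exact_mod_cast h3

end Rational

/-! ### Convex hulls and affine spans of finite families -/

theorem sum_subtype_eq_sum {ι M : Type*} [Fintype ι] [AddCommMonoid M] {A : Set ι} [Fintype A]
    (f : ι → M) (hf : ∀ i ∉ A, f i = 0) : ∑ i : A, f i = ∑ i, f i := by
  classical
  rw [← Finset.sum_subset (Finset.filter_subset (· ∈ A) Finset.univ)
    fun i _ hi => hf i (by simpa using hi)]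
  exact (Finset.sum_subtype _ (by simp) f).symm

section Hull

variable {ι E : Type*} [Fintype ι] [AddCommGroup E] [Module ℝ E]

/-- Weights live on the whole index type and vanish off `A`, so that weights for different subsets
can be subtracted. -/
theorem mem_convexHull_image_iff (p : ι → E) (A : Set ι) (x : E) :
    x ∈ convexHull ℝ (p '' A) ↔ ∃ w : ι → ℝ, (∀ i, 0 ≤ w i) ∧ (∀ i ∉ A, w i = 0) ∧
      ∑ i, w i = 1 ∧ ∑ i, w i • p i = x := by
  classical
  constructor
  · let C : Set E := {x | ∃ w : ι → ℝ, (∀ i, 0 ≤ w i) ∧ (∀ i ∉ A, w i = 0) ∧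
      ∑ i, w i = 1 ∧ ∑ i, w i • p i = x}
    have hC : Convex ℝ C := by
      rintro _ ⟨w, h1, h2, h3, rfl⟩ _ ⟨w', h1', h2', h3', rfl⟩ a b ha hb hab
      refine ⟨fun i => a * w i + b * w' i, fun i => ?_, fun i hi => ?_, ?_, ?_⟩
      · have := h1 i
        have := h1' i
        positivity
      · simp [h2 i hi, h2' i hi]
      · rw [Finset.sum_add_distrib, ← Finset.mul_sum, ← Finset.mul_sum, h3, h3', mul_one, mul_one,
          hab]
      · simp [add_smul, mul_smul, Finset.sum_add_distrib, Finset.smul_sum]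
    have hsub : p '' A ⊆ C := by
      rintro _ ⟨i, hi, rfl⟩
      refine ⟨Pi.single i 1, fun j => ?_, fun j hj => ?_, by simp, ?_⟩
      · by_cases h : j = i
        · subst h; simp
        · simp [h]
      · exact Pi.single_eq_of_ne (by rintro rfl; exact hj hi) _
      · simp [Pi.single_apply]
    exact fun hx => convexHull_min hsub hC hx
  · rintro ⟨w, h1, h2, h3, rfl⟩
    have hs : ∀ i ∈ Finset.univ, i ∉ Finset.univ.filter (· ∈ A) → w i = 0 := fun i _ hi =>
      h2 i (by simpa using hi)
    rw [← Finset.sum_subset (Finset.filter_subset (· ∈ A) Finset.univ)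
      fun i hi hi' => by rw [hs i hi hi', zero_smul]]
    refine (convex_convexHull ℝ _).sum_mem (fun i _ => h1 i) ?_ fun i hi => ?_
    · rw [← h3]
      exact Finset.sum_subset (Finset.filter_subset _ _) hs
    · exact subset_convexHull ℝ _ ⟨i, by simpa using hi, rfl⟩

theorem exists_weights_of_mem_affineSpan_image (p : ι → E) (A : Set ι) (x : E)
    (hx : x ∈ affineSpan ℝ (p '' A)) : ∃ w : ι → ℝ, (∀ i ∉ A, w i = 0) ∧
      ∑ i, w i = 1 ∧ ∑ i, w i • p i = x := by
  classical
  obtain ⟨s, w, hs, hw, rfl⟩ := eq_affineCombination_of_mem_affineSpan_image hx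
  refine ⟨fun i => if i ∈ s then w i else 0, fun i hi => if_neg fun h => hi (hs h), ?_, ?_⟩
  · simpa using hw
  · rw [Finset.affineCombination_eq_linear_combination s p w hw]
    simp [ite_smul]

/-- Affine independence of a subfamily of a finite family in terms of weights on the whole
family. -/
theorem affineIndependent_subtype_iff (p : ι → E) (A : Set ι) :
    AffineIndependent ℝ (fun i : A => p i) ↔ ∀ w : ι → ℝ, (∀ i ∉ A, w i = 0) →
      ∑ i, w i = 0 → ∑ i, w i • p i = 0 → w = 0 := by
  classical
  rw [affineIndependent_iff]
  constructor
  · intro h w hw h0 h1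
    ext i
    by_cases hi : i ∈ A
    · refine h Finset.univ (fun i => w i) ?_ ?_ ⟨i, hi⟩ (Finset.mem_univ _)
      · rw [sum_subtype_eq_sum w hw, h0]
      · rw [sum_subtype_eq_sum (fun i => w i • p i) (fun i hi => by rw [hw i hi, zero_smul]), h1]
    · exact hw i hi
  · intro h s w h0 h1 i hi
    let w' : ι → ℝ := fun i => if hi : i ∈ A then (if ⟨i, hi⟩ ∈ s then w ⟨i, hi⟩ else 0) else 0
    have hw' : ∀ i : A, w' i = if i ∈ s then w i else 0 := fun i => by simp [w']
    have hA : ∀ i ∉ A, w' i = 0 := fun i hi => by simp [w', hi]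
    have := h w' hA ?_ ?_
    · have h2 := hw' i
      rw [this] at h2
      simpa [hi] using h2.symm
    · rw [← sum_subtype_eq_sum w' hA]
      simpa [hw'] using h0
    · rw [← sum_subtype_eq_sum (fun i => w' i • p i) (fun i hi => by rw [hA i hi, zero_smul])]
      simpa [hw', ite_smul] using h1

end Hull

/-! ### Coordinate subspaces -/

section Coordinate

variable {ι : Type}

/-- The submodule of `R^ι` of the vectors that are supported on `A`. -/
def coordinateSubspace (R : Type*) [CommRing R] (A : Set ι) : Submodule R (ι → R) where
  carrier := {v | ∀ i ∉ A, v i = 0}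
  add_mem' hv hw i hi := by simp [hv i hi, hw i hi]
  zero_mem' _ _ := rfl
  smul_mem' a v hv i hi := by simp [hv i hi]

theorem coordinateSubspace_injective (R : Type*) [CommRing R] [Nontrivial R] :
    Function.Injective (coordinateSubspace R : Set ι → Submodule R (ι → R)) := by
  classical
  have key : ∀ A B : Set ι, coordinateSubspace R A = coordinateSubspace R B → A ⊆ B := by
    intro A B h i hi
    by_contra hB
    have : Pi.single i (1 : R) ∈ coordinateSubspace R A := fun j hj =>
      Pi.single_eq_of_ne (by rintro rfl; exact hj hi) _
    rw [h] at this
    simpa using this i hB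
  exact fun A B h => (key A B h).antisymm (key B A h.symm)

theorem isCompl_coordinateSubspace (R : Type*) [CommRing R] (A : Set ι) :
    IsCompl (coordinateSubspace R A) (coordinateSubspace R Aᶜ) := by
  classical
  refine ⟨Submodule.disjoint_def.2 fun v h1 h2 => ?_, codisjoint_iff.2 ?_⟩
  · ext i
    by_cases hi : i ∈ A
    · exact h2 i (by simpa using hi)
    · exact h1 i hi
  · refine eq_top_iff.2 fun v _ => Submodule.mem_sup.2
      ⟨fun i => if i ∈ A then v i else 0, fun i hi => if_neg hi,
        fun i => if i ∈ A then 0 else v i, fun i hi => if_pos (by simpa using hi), ?_⟩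
    ext i
    by_cases hi : i ∈ A <;> simp [hi]

theorem finrank_coordinateSubspace [Finite ι] (K : Type*) [Field K] (A : Set ι) :
    Module.finrank K (coordinateSubspace K A) = A.ncard := by
  classical
  have := Fintype.ofFinite ι
  let e : coordinateSubspace K A ≃ₗ[K] (A → K) :=
    { toFun := fun v i => (v : ι → K) i
      invFun := fun w => ⟨fun i => if hi : i ∈ A then w ⟨i, hi⟩ else 0, fun i hi => by simp [hi]⟩
      map_add' := fun _ _ => rfl
      map_smul' := fun _ _ => rfl
      left_inv := fun v => by
        ext i
        by_cases hi : i ∈ A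
        · simp [hi]
        · simpa [hi] using (v.2 i hi).symm
      right_inv := fun w => by ext i; simp }
  rw [e.finrank_eq, Module.finrank_fintype_fun_eq_card, ← Nat.card_eq_fintype_card,
    Nat.card_coe_set_eq]

theorem mem_of_single_mem [Finite ι] [DecidableEq ι] {R : Type*} [CommRing R]
    (W : Submodule R (ι → R)) (v : ι → R) (h : ∀ i, Pi.single i (v i) ∈ W) : v ∈ W := by
  have := Fintype.ofFinite ι
  rw [← Finset.univ_sum_single v]
  exact Submodule.sum_mem _ fun i _ => h i

theorem single_mem_of_single_ne_zero [DecidableEq ι] {K : Type*} [Field K]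
    (W : Submodule K (ι → K)) {i : ι} {a : K} (b : K) (ha : a ≠ 0)
    (h : Pi.single i a ∈ W) : Pi.single i b ∈ W := by
  have := W.smul_mem (b / a) h
  rwa [← Pi.single_smul, smul_eq_mul, div_mul_cancel₀ _ ha] at this

/-- Reduces questions over all `K`-algebras, both containment in `X_P` and invariance under the
group scheme, to coordinate subspaces over each ring. -/
theorem baseChange_coordinateSubspace [Finite ι] {R S : Type u} [CommRing R] [CommRing S]
    (φ : R →+* S) (A : Set ι) :
    baseChange φ (coordinateSubspace R A) = coordinateSubspace S A := by
  classical
  apply le_antisymm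
  · refine Submodule.span_le.2 ?_
    rintro _ ⟨v, hv, rfl⟩ i hi
    simp [hv i hi]
  · refine fun v hv => mem_of_single_mem _ _ fun i => ?_
    by_cases hi : i ∈ A
    · have h1 : (Pi.single i (1 : S) : ι → S) ∈ baseChange φ (coordinateSubspace R A) := by
        refine Submodule.subset_span ⟨Pi.single i 1, fun j hj =>
          Pi.single_eq_of_ne (by rintro rfl; exact hj hi) _, ?_⟩
        ext j
        by_cases h : j = i
        · subst h; simp
        · simp [h]
      have := Submodule.smul_mem _ (v i) h1
      rwa [← Pi.single_smul, smul_eq_mul, mul_one] at this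
    · simp [hv i hi]

theorem linearSubspace_subset_iff {K : Type u} [Field K] {W W' : Submodule K (ι → K)} :
    linearSubspace W ⊆ linearSubspace W' ↔ W ≤ W' := by
  refine ⟨fun h v hv => ?_, fun h p hp => le_trans hp h⟩
  by_cases h0 : v = 0
  · simp [h0]
  · have : Projectivization.mk K v h0 ∈ linearSubspace W := by
      simpa [linearSubspace, Projectivization.submodule_mk] using hv
    simpa [linearSubspace, Projectivization.submodule_mk] using h this

theorem mem_linearSubspace_iff {K : Type u} [Field K] (W : Submodule K (ι → K))
    (p : Projectivization K (ι → K)) : p ∈ linearSubspace W ↔ p.rep ∈ W := by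
  simp [linearSubspace, Projectivization.submodule_eq]

end Coordinate

/-! ### Characters of the torus -/

section Character

variable {K : Type u} [Field K] {m : ℕ}

theorem exists_pow_ne_one [Infinite K] {n : ℕ} (hn : 0 < n) : ∃ x : Kˣ, x ^ n ≠ 1 := by
  by_contra! h
  have : NeZero n := ⟨hn.ne'⟩
  have h1 : (rootsOfUnity n K : Set Kˣ) = Set.univ :=
    Set.eq_univ_of_forall fun x => (mem_rootsOfUnity n x).2 (h x)
  have h2 : Finite (rootsOfUnity n K) := inferInstance
  have : Finite Kˣ := Set.finite_univ_iff.1 (h1 ▸ Set.finite_coe_iff.1 h2)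
  -- If all units were `n`-th roots of unity there would be finitely many; adjoining zero exhausts
  -- `K`.
  refine not_finite_iff_infinite.2 ‹Infinite K› (Finite.of_surjective
    (fun o : Option Kˣ => o.elim (0 : K) (fun x => (x : K))) fun x => ?_)
  by_cases hx : x = 0
  · exact ⟨none, hx.symm⟩
  · exact ⟨some (Units.mk0 x hx), rfl⟩

theorem exists_pow_ne_pow [Infinite K] {a b : ℕ} (hab : a ≠ b) :
    ∃ x : K, x ^ a ≠ x ^ b := by
  wlog h : a < b generalizing a b
  · obtain ⟨x, hx⟩ := this hab.symm (lt_of_le_of_ne (not_lt.1 h) hab.symm)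
    exact ⟨x, hx.symm⟩
  obtain ⟨x, hx⟩ := exists_pow_ne_one (K := K) (Nat.sub_pos_of_lt h)
  refine ⟨x, fun he => hx ?_⟩
  have h1 : x ^ a = x ^ b := Units.ext (by simpa using he)
  rw [pow_sub x h.le, h1, mul_inv_cancel]

/-- Restriction to the `i`-th factor of the torus turns the character into `x ↦ x ^ u i`, which
detects the `i`-th coordinate. -/
theorem character_injective [Infinite K] :
    Function.Injective (fun u : Fin m → ℤ => (character u : Torus m K →* Kˣ)) := by
  intro u v h
  ext i
  by_contra hne
  obtain ⟨x, hx⟩ := exists_pow_ne_one (K := K) (Int.natAbs_pos.2 (sub_ne_zero.2 hne))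
  have hc : ∀ w : Fin m → ℤ, character w (Pi.mulSingle i x : Torus m K) = x ^ w i := by
    intro w
    change ∏ j, (Pi.mulSingle i x : Torus m K) j ^ w j = _
    rw [Finset.prod_eq_single i (fun j _ hj => by simp [Pi.mulSingle_eq_of_ne hj]) (by simp),
      Pi.mulSingle_eq_same]
  have h1 := DFunLike.congr_fun h (Pi.mulSingle i x : Torus m K)
  simp only [hc] at h1
  have h2 : x ^ (u i - v i) = 1 := by rw [zpow_sub, h1, mul_inv_cancel]
  apply hx
  rcases Int.natAbs_eq (u i - v i) with h3 | h3
  · rw [h3, zpow_natCast] at h2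
    exact h2
  · rw [h3, zpow_neg, zpow_natCast, inv_eq_one] at h2
    exact h2

/-- Distinct characters of the torus are linearly independent. -/
theorem eq_zero_of_sum_character [Infinite K] {J : Type*} (s : Finset J) (w : J → Fin m → ℤ)
    (hw : Set.InjOn w s) (c : J → K)
    (h : ∀ t : Torus m K, ∑ j ∈ s, c j * (character (w j) t : K) = 0) : ∀ j ∈ s, c j = 0 := by
  let χ : s → (Torus m K →* K) := fun j => (Units.coeHom K).comp (character (w j))
  have hχ : Function.Injective χ := by
    intro i j hij
    refine Subtype.ext (hw i.2 j.2 (character_injective (K := K) ?_))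
    exact MonoidHom.ext fun t => Units.ext (DFunLike.congr_fun hij t)
  -- Dedekind's independence of characters.
  have hli := (linearIndependent_monoidHom (Torus m K) K).comp χ hχ
  have h0 := Fintype.linearIndependent_iff.1 hli (fun j => c j) (by
    ext t
    have := h t
    rw [← Finset.sum_coe_sort] at this
    simpa [χ] using this)
  exact fun j hj => h0 ⟨j, hj⟩

/-- A subspace that contains a torus orbit contains the coordinate components of its points. -/
theorem single_mem_of_torusEquiv_mem [Infinite K] {P : LatticePolytope m}
    [DecidableEq P.latticePoints] (W : Submodule K (P.latticePoints → K))
    (v : P.latticePoints → K) (h : ∀ t : Torus m K, torusEquiv P t v ∈ W) (u : P.latticePoints) :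
    Pi.single u (v u) ∈ W := by
  have := Fintype.ofFinite P.latticePoints
  by_contra hu
  -- A functional `g` killing `W` but not this component would, evaluated along the orbit of `v`,
  -- give a vanishing combination of distinct characters.
  obtain ⟨g, hg, hW⟩ := Submodule.exists_le_ker_of_notMem hu
  refine hg ?_
  have hs : ∀ w : P.latticePoints → K, g w = ∑ i, g (Pi.single i (w i)) := fun w => by
    rw [← map_sum, Finset.univ_sum_single]
  refine eq_zero_of_sum_character Finset.univ (fun i : P.latticePoints => (i : Fin m → ℤ))
    Subtype.val_injective.injOn (fun i => g (Pi.single i (v i))) (fun t => ?_) u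
    (Finset.mem_univ _)
  have h1 : g (torusEquiv P t v) = 0 := hW (h t)
  rw [hs] at h1
  rw [← h1]
  refine Finset.sum_congr rfl fun i _ => ?_
  rw [torusEquiv_apply, ← smul_eq_mul (character _ t : K), Pi.single_smul, map_smul, smul_eq_mul,
    mul_comm]

/-- A torus-invariant subspace is a coordinate subspace. -/
theorem eq_coordinateSubspace_of_torusEquiv_mem [Infinite K] {P : LatticePolytope m}
    (W : Submodule K (P.latticePoints → K))
    (h : ∀ t : Torus m K, ∀ v ∈ W, torusEquiv P t v ∈ W) :
    ∃ A : Set P.latticePoints, W = coordinateSubspace K A := by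
  classical
  refine ⟨{u | Pi.single u 1 ∈ W}, le_antisymm (fun v hv u hu => ?_) fun v hv => ?_⟩
  · by_contra h0
    exact hu (single_mem_of_single_ne_zero W 1 h0
      (single_mem_of_torusEquiv_mem W v (fun t => h t v hv) u))
  · refine mem_of_single_mem _ _ fun u => ?_
    by_cases hu : Pi.single u 1 ∈ W
    · exact single_mem_of_single_ne_zero W _ one_ne_zero hu
    · rw [hv u hu, Pi.single_zero]
      exact W.zero_mem

theorem torusEquiv_mem_coordinateSubspace {R : Type u} [CommRing R] {P : LatticePolytope m}
    (t : Torus m R) {A : Set P.latticePoints} {v : P.latticePoints → R}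
    (hv : v ∈ coordinateSubspace R A) : torusEquiv P t v ∈ coordinateSubspace R A := by
  intro u hu
  rw [torusEquiv_apply, hv u hu, mul_zero]

theorem map_torusEquiv_coordinateSubspace {R : Type u} [CommRing R] {P : LatticePolytope m}
    (t : Torus m R) (A : Set P.latticePoints) :
    (coordinateSubspace R A).map (torusEquiv P t).toLinearMap = coordinateSubspace R A := by
  refine le_antisymm (Submodule.map_le_iff_le_comap.2 fun v hv =>
    torusEquiv_mem_coordinateSubspace t hv) fun v hv =>
      ⟨torusEquiv P t⁻¹ v, torusEquiv_mem_coordinateSubspace _ hv, ?_⟩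
  ext u
  simp [torusEquiv_apply]

end Character

/-! ### Points of the toric variety in terms of monomials -/

section Monomial

variable {m : ℕ} {P : LatticePolytope m}

/-- The degree in `S_P` of a monomial in the coordinates `x_u`. -/
noncomputable def expDegree (P : LatticePolytope m) : (P.latticePoints →₀ ℕ) →+ semigroup P :=
  Finsupp.liftAddHom fun u => multiplesHom _ (semigroupGen P u)

theorem expDegree_single (u : P.latticePoints) (n : ℕ) :
    expDegree P (Finsupp.single u n) = n • semigroupGen P u := by
  simp [expDegree]

theorem expDegree_apply [Fintype P.latticePoints] (a : P.latticePoints →₀ ℕ) :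
    expDegree P a = ∑ u, a u • semigroupGen P u := by
  simp [expDegree, Finsupp.sum_fintype]

theorem expDegree_eq_iff [Fintype P.latticePoints] (a b : P.latticePoints →₀ ℕ) :
    expDegree P a = expDegree P b ↔
      ∑ u, a u • (u : Fin m → ℤ) = ∑ u, b u • (u : Fin m → ℤ) ∧ ∑ u, a u = ∑ u, b u := by
  have h : ∀ a : P.latticePoints →₀ ℕ, ((expDegree P a : semigroup P) : (Fin m → ℤ) × ℤ) =
      (∑ u, a u • (u : Fin m → ℤ), ((∑ u, a u : ℕ) : ℤ)) := by
    intro a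
    rw [expDegree_apply]
    ext
    · simp [semigroupGen, Prod.fst_sum]
    · simp [semigroupGen, Prod.snd_sum]
  rw [← Subtype.coe_inj, h, h, Prod.mk.injEq, Nat.cast_inj]

theorem toricHom_monomial {K : Type u} [Field K] (a : P.latticePoints →₀ ℕ) (c : K) :
    toricHom K P (MvPolynomial.monomial a c) = AddMonoidAlgebra.single (expDegree P a) c := by
  suffices h : toricHom K P (MvPolynomial.monomial a 1) =
      AddMonoidAlgebra.single (expDegree P a) 1 by
    rw [← mul_one c, ← smul_eq_mul, ← MvPolynomial.smul_monomial, map_smul, h,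
      AddMonoidAlgebra.smul_single]
  induction a using Finsupp.induction with
  | zero =>
    rw [map_zero]
    exact map_one (toricHom K P)
  | single_add u n a _ _ ih =>
    rw [← one_mul (1 : K), ← MvPolynomial.monomial_mul, map_mul, ih, map_add, one_mul,
      ← one_mul (1 : K), ← AddMonoidAlgebra.single_mul_single, one_mul, expDegree_single,
      ← MvPolynomial.X_pow_eq_monomial]
    simp [toricHom, AddMonoidAlgebra.single_pow]

/-- The condition that all monomials of the same degree in `S_P` take the same value at `v`. -/
def IsToricPoint {R : Type*} [CommRing R] (v : P.latticePoints → R) : Prop :=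
  ∀ a b : P.latticePoints →₀ ℕ, expDegree P a = expDegree P b →
    (a.prod fun u n => v u ^ n) = b.prod fun u n => v u ^ n

/-- The monomials form a basis, so equality on monomials of equal degree lets evaluation at `v`
factor through `K[S_P]` as a linear map. The converse tests binomials `x^a - x^b`. -/
theorem isToricPoint_iff {K R : Type u} [Field K] [CommRing R] [Algebra K R]
    (v : P.latticePoints → R) :
    IsToricPoint v ↔ ∀ f ∈ toricIdeal K P, MvPolynomial.aeval v f = 0 := by
  constructor
  · intro h f hf
    -- The default value `0` is immaterial: `ψ` is only evaluated at degrees of monomials.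
    let ψ : semigroup P → R := Function.extend (expDegree P) (fun a => a.prod fun u n => v u ^ n) 0
    have hψ : ∀ a, ψ (expDegree P a) = a.prod fun u n => v u ^ n := fun a =>
      Function.FactorsThrough.extend_apply (fun a b hab => h a b hab) 0 a
    let L : AddMonoidAlgebra K (semigroup P) →ₗ[K] R :=
      (Finsupp.linearCombination K ψ) ∘ₗ (AddMonoidAlgebra.coeffLinearEquiv K).toLinearMap
    have hL : L ∘ₗ (toricHom K P).toLinearMap = (MvPolynomial.aeval v).toLinearMap := by
      refine MvPolynomial.linearMap_ext fun a => ?_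
      ext
      simp [L, toricHom_monomial, hψ, MvPolynomial.aeval_monomial]
    have h1 := LinearMap.congr_fun hL f
    have h2 : toricHom K P f = 0 := hf
    simpa [h2] using h1.symm
  · intro h a b hab
    have := h (MvPolynomial.monomial a 1 - MvPolynomial.monomial b 1) (by
      change toricHom K P _ = 0
      rw [map_sub, toricHom_monomial, toricHom_monomial, hab, sub_self])
    simpa [MvPolynomial.aeval_monomial, sub_eq_zero] using this

/-- Orbit points and rescaled representatives are products of constants, character vectors and face
points. -/
theorem IsToricPoint.mul {R : Type*} [CommRing R] {v w : P.latticePoints → R}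
    (hv : IsToricPoint v) (hw : IsToricPoint w) : IsToricPoint (v * w) := by
  intro a b hab
  simp only [Pi.mul_apply, mul_pow, Finsupp.prod_mul]
  rw [hv a b hab, hw a b hab]

theorem isToricPoint_const {R : Type*} [CommRing R] (c : R) :
    IsToricPoint (fun _ : P.latticePoints => c) := by
  have := Fintype.ofFinite P.latticePoints
  intro a b hab
  rw [Finsupp.prod_fintype _ _ fun _ => pow_zero _, Finsupp.prod_fintype _ _ fun _ => pow_zero _,
    Finset.prod_pow_eq_pow_sum, Finset.prod_pow_eq_pow_sum, ((expDegree_eq_iff a b).1 hab).2]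

theorem prod_character {R : Type u} [CommRing R] [Fintype P.latticePoints] (t : Torus m R)
    (a : P.latticePoints →₀ ℕ) :
    (a.prod fun u n => (character (u : Fin m → ℤ) t : R) ^ n) =
      (character (∑ u, a u • (u : Fin m → ℤ)) t : R) := by
  let χ : Multiplicative (Fin m → ℤ) →* R :=
    { toFun := fun u => (character u.toAdd t : R)
      map_one' := by simp [character_zero]
      map_mul' := fun u v => by simp [character_add] }
  have h := map_prod χ (fun u : P.latticePoints => Multiplicative.ofAdd (a u • (u : Fin m → ℤ)))
    Finset.univ
  rw [Finsupp.prod_fintype _ _ fun _ => pow_zero _]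
  have h1 : ∀ u : P.latticePoints, χ (Multiplicative.ofAdd (a u • (u : Fin m → ℤ))) =
      (character (u : Fin m → ℤ) t : R) ^ a u := fun u => by
    rw [ofAdd_nsmul, map_pow]
    rfl
  simp only [h1, ← ofAdd_sum] at h
  exact h.symm

theorem isToricPoint_character {R : Type u} [CommRing R] (t : Torus m R) :
    IsToricPoint (fun u : P.latticePoints => (character (u : Fin m → ℤ) t : R)) := by
  have := Fintype.ofFinite P.latticePoints
  intro a b hab
  rw [prod_character, prod_character, ((expDegree_eq_iff a b).1 hab).1]

end Monomial

/-! ### Faces of lattice polytopes -/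

section Face

variable {m : ℕ} {P : LatticePolytope m}

/-- The lattice points of `P` that lie in `Q`. -/
def latticePointsIn (P : LatticePolytope m) (Q : Set (Fin m → ℝ)) : Set P.latticePoints :=
  {u | toReal (u : Fin m → ℤ) ∈ Q}

theorem toReal_sum {J : Type*} (s : Finset J) (a : J → ℕ) (u : J → Fin m → ℤ) :
    toReal (∑ j ∈ s, a j • u j) = ∑ j ∈ s, (a j : ℝ) • toReal (u j) := by
  ext i
  simp [toReal, Finset.sum_apply]

theorem LatticePolytope.convex_carrier (P : LatticePolytope m) : Convex ℝ P.carrier := by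
  obtain ⟨V, hV⟩ := P.exists_eq_convexHull
  rw [hV]
  exact convex_convexHull ℝ _

theorem LatticePolytope.carrier_eq_convexHull (P : LatticePolytope m) : P.carrier =
    convexHull ℝ ((fun u : P.latticePoints => toReal (u : Fin m → ℤ)) '' Set.univ) := by
  apply subset_antisymm
  · obtain ⟨V, hV⟩ := P.exists_eq_convexHull
    have hsub : toReal '' (V : Set (Fin m → ℤ)) ⊆ P.carrier := by
      rw [hV]
      exact subset_convexHull ℝ _
    conv_lhs => rw [hV]
    refine convexHull_mono ?_
    rintro _ ⟨u, hu, rfl⟩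
    exact ⟨⟨u, hsub ⟨u, hu, rfl⟩⟩, trivial, rfl⟩
  · refine convexHull_min ?_ P.convex_carrier
    rintro _ ⟨u, _, rfl⟩
    exact u.2

theorem IsFace.exists_functional {Q : Set (Fin m → ℝ)} (hQ : IsFace P Q) :
    ∃ (l : StrongDual ℝ (Fin m → ℝ)) (c : ℝ), (∀ y ∈ P.carrier, l y ≤ c) ∧
      Q = {x ∈ P.carrier | l x = c} := by
  obtain ⟨l, hl⟩ := hQ.1 hQ.2
  obtain ⟨q, hq⟩ := hQ.2
  have hq' := hq
  rw [hl] at hq'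
  refine ⟨l, l q, hq'.2, ?_⟩
  rw [hl]
  ext x
  exact and_congr_right fun hx => ⟨fun h => (hq'.2 x hx).antisymm (h q hq'.1),
    fun h y hy => (hq'.2 y hy).trans h.ge⟩

theorem IsFace.subset {Q : Set (Fin m → ℝ)} (hQ : IsFace P Q) : Q ⊆ P.carrier := hQ.1.subset

theorem isFace_of_functional {l : StrongDual ℝ (Fin m → ℝ)} {c : ℝ}
    (hl : ∀ y ∈ P.carrier, l y ≤ c) (hne : {x ∈ P.carrier | l x = c}.Nonempty) :
    IsFace P {x ∈ P.carrier | l x = c} := by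
  refine ⟨fun _ => ⟨l, ?_⟩, hne⟩
  obtain ⟨q, hq⟩ := hne
  ext x
  exact and_congr_right fun hx => ⟨fun h y hy => (hl y hy).trans h.ge,
    fun h => (hl x hx).antisymm (hq.2.symm.trans_le (h q hq.1))⟩

/-- The terms `w u * (c - l u)` are nonnegative and sum to zero. It serves both for barycentric
weights and for exponents of monomials. -/
theorem eq_zero_of_functional_eq [Fintype P.latticePoints] {l : StrongDual ℝ (Fin m → ℝ)} {c : ℝ}
    (hl : ∀ y ∈ P.carrier, l y ≤ c) (w : P.latticePoints → ℝ) (hw : ∀ u, 0 ≤ w u)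
    (h : l (∑ u, w u • toReal (u : Fin m → ℤ)) = (∑ u, w u) * c) (u : P.latticePoints)
    (hu : l (toReal (u : Fin m → ℤ)) ≠ c) : w u = 0 := by
  have h0 : ∑ u, w u * (c - l (toReal (u : Fin m → ℤ))) = 0 := by
    simp only [mul_sub, Finset.sum_sub_distrib, ← Finset.sum_mul, ← h, map_sum, map_smul,
      smul_eq_mul, sub_self]
  have h1 := (Finset.sum_eq_zero_iff_of_nonneg fun u _ =>
    mul_nonneg (hw u) (sub_nonneg.2 (hl _ u.2))).1 h0 u (Finset.mem_univ u)
  exact (mul_eq_zero.1 h1).resolve_right (sub_ne_zero.2 hu.symm)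

/-- A face is the convex hull of its lattice points. -/
theorem IsFace.eq_convexHull {Q : Set (Fin m → ℝ)} (hQ : IsFace P Q) : Q =
    convexHull ℝ ((fun u : P.latticePoints => toReal (u : Fin m → ℤ)) '' latticePointsIn P Q) := by
  have := Fintype.ofFinite P.latticePoints
  obtain ⟨l, c, hl, hQl⟩ := hQ.exists_functional
  apply subset_antisymm
  · intro x hx
    have hx' := hx
    rw [hQl] at hx'
    have hxP := hx'.1
    rw [P.carrier_eq_convexHull, mem_convexHull_image_iff] at hxP
    obtain ⟨w, h0, _, h1, h2⟩ := hxP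
    refine (mem_convexHull_image_iff _ _ _).2 ⟨w, h0, fun u hu => ?_, h1, h2⟩
    refine eq_zero_of_functional_eq hl w h0 ?_ u fun h => hu ?_
    · rw [h2, h1, one_mul, hx'.2]
    · rw [latticePointsIn, Set.mem_ofPred_eq, hQl]
      exact ⟨u.2, h⟩
  · have hconv : Convex ℝ Q := hQ.1.convex P.convex_carrier
    refine convexHull_min ?_ hconv
    rintro _ ⟨u, hu, rfl⟩
    exact hu

theorem IsFace.latticePointsIn_nonempty {Q : Set (Fin m → ℝ)} (hQ : IsFace P Q) :
    (latticePointsIn P Q).Nonempty := by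
  have h := hQ.2
  rw [hQ.eq_convexHull, convexHull_nonempty_iff, Set.image_nonempty] at h
  exact h

/-- Primitivity forces the vertices of the simplex to be all the lattice points of `Q`; conversely a
face is the hull of its lattice points. -/
theorem IsFace.isPrimitiveSimplex_iff {Q : Set (Fin m → ℝ)} (hQ : IsFace P Q) (d : ℕ) :
    IsPrimitiveSimplex d Q ↔
      AffineIndependent ℝ (fun u : latticePointsIn P Q => toReal u.1.1) ∧
        (latticePointsIn P Q).ncard = d + 1 := by
  constructor
  · rintro ⟨v, hv, hQv, hmem⟩
    have hvQ : ∀ i, toReal (v i) ∈ Q := fun i => by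
      rw [hQv]
      exact subset_convexHull ℝ _ ⟨i, rfl⟩
    let f : Fin (d + 1) → latticePointsIn P Q := fun i => ⟨⟨v i, hQ.subset (hvQ i)⟩, hvQ i⟩
    have hf : Function.Bijective f := by
      refine ⟨fun i j hij => hv.injective ?_, fun u => ?_⟩
      · exact congrArg (fun u : latticePointsIn P Q => toReal u.1.1) hij
      · obtain ⟨i, hi⟩ := hmem u.1.1 u.2
        exact ⟨i, Subtype.ext (Subtype.ext hi)⟩
    let e := Equiv.ofBijective f hf
    refine ⟨(affineIndependent_equiv e).1 hv, ?_⟩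
    rw [← Nat.card_coe_set_eq, ← Nat.card_congr e, Nat.card_eq_fintype_card, Fintype.card_fin]
  · rintro ⟨hA, hcard⟩
    rw [← Nat.card_coe_set_eq] at hcard
    let e := (Finite.equivFinOfCardEq hcard).symm
    refine ⟨fun i => ((e i : P.latticePoints) : Fin m → ℤ), (affineIndependent_equiv e).2 hA,
      ?_, fun u hu => ?_⟩
    · rw [← Set.image_univ]
      conv_lhs => rw [hQ.eq_convexHull]
      congr 1
      ext x
      constructor
      · rintro ⟨u, hu, rfl⟩
        exact ⟨e.symm ⟨u, hu⟩, trivial, by simp⟩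
      · rintro ⟨i, _, rfl⟩
        exact ⟨e i, (e i).2, rfl⟩
    · exact ⟨e.symm ⟨⟨u, hQ.subset hu⟩, hu⟩, by simp⟩

/-- Monomials of the same degree in `S_P` give the same real combination of lattice points. -/
theorem real_sum_eq_of_expDegree_eq [Fintype P.latticePoints] {a b : P.latticePoints →₀ ℕ}
    (h : expDegree P a = expDegree P b) :
    ∑ u, (a u : ℝ) • toReal (u : Fin m → ℤ) = ∑ u, (b u : ℝ) • toReal (u : Fin m → ℤ) ∧
      ∑ u, (a u : ℝ) = ∑ u, (b u : ℝ) := by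
  obtain ⟨h1, h2⟩ := (expDegree_eq_iff a b).1 h
  rw [← toReal_sum, ← toReal_sum, h1]
  exact ⟨rfl, by exact_mod_cast h2⟩

/-- A real affine relation between lattice points yields two monomials of the same degree. -/
theorem exists_expDegree_eq [Fintype P.latticePoints] (c : P.latticePoints → ℝ)
    (h0 : ∑ u, c u = 0) (h1 : ∑ u, c u • toReal (u : Fin m → ℤ) = 0) :
    ∃ a b : P.latticePoints →₀ ℕ, expDegree P a = expDegree P b ∧
      (∀ u, a u ≠ 0 ↔ 0 < c u) ∧ ∀ u, b u ≠ 0 ↔ c u < 0 := by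
  obtain ⟨n, hn, hr⟩ := exists_int_sign_eq c
  have hsum : ∑ u, n u = 0 := by simpa using hr (fun _ => 1) (by simpa using h0)
  have hcoord : ∀ i, ∑ u : P.latticePoints, (u : Fin m → ℤ) i * n u = 0 := fun i => by
    refine hr (fun u => (u : Fin m → ℤ) i) ?_
    have := congrFun h1 i
    simpa [toReal, Finset.sum_apply, mul_comm] using this
  have hsub : ∀ u, (((n u).toNat : ℕ) : ℤ) - ((-n u).toNat : ℕ) = n u := fun u => by omega
  -- The exponents are the positive and negative parts of the integral relation `n`.
  refine ⟨Finsupp.equivFunOnFinite.symm fun u => (n u).toNat,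
    Finsupp.equivFunOnFinite.symm fun u => (-n u).toNat,
    (expDegree_eq_iff _ _).2 ⟨?_, ?_⟩, fun u => ?_, fun u => ?_⟩
  · ext i
    rw [← sub_eq_zero, Finset.sum_apply, Finset.sum_apply, ← Finset.sum_sub_distrib, ← hcoord i]
    refine Finset.sum_congr rfl fun u _ => ?_
    conv_rhs => rw [mul_comm, ← hsub u, sub_mul]
    simp [-Int.ofNat_toNat]
  · rw [← Nat.cast_inj (R := ℤ), ← sub_eq_zero]
    simpa [← Finset.sum_sub_distrib, hsub, -Int.ofNat_toNat] using hsum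
  · rw [← sign_eq_one_iff, ← hn u, sign_eq_one_iff]
    simp
  · rw [← sign_eq_neg_one_iff, ← hn u, sign_eq_neg_one_iff]
    simp

/-- Whether a monomial is supported on a face depends only on its degree. -/
theorem IsFace.eq_zero_of_expDegree_eq {Q : Set (Fin m → ℝ)} (hQ : IsFace P Q)
    {a b : P.latticePoints →₀ ℕ} (hab : expDegree P a = expDegree P b)
    (ha : ∀ u ∉ latticePointsIn P Q, a u = 0) : ∀ u ∉ latticePointsIn P Q, b u = 0 := by
  have := Fintype.ofFinite P.latticePoints
  obtain ⟨l, c, hl, hQl⟩ := hQ.exists_functional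
  obtain ⟨h1, h2⟩ := real_sum_eq_of_expDegree_eq hab
  have hmem : ∀ u, u ∈ latticePointsIn P Q ↔ l (toReal (u : Fin m → ℤ)) = c := fun u => by
    rw [latticePointsIn, Set.mem_ofPred_eq, hQl]
    exact and_iff_right u.2
  intro u hu
  have h := eq_zero_of_functional_eq hl (fun u => (b u : ℝ)) (fun u => Nat.cast_nonneg _) ?_ u
    (fun h => hu ((hmem u).2 h))
  · exact_mod_cast h
  · rw [← h1, ← h2, map_sum, Finset.sum_mul]
    refine Finset.sum_congr rfl fun u _ => ?_
    rw [map_smul, smul_eq_mul]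
    by_cases hu : u ∈ latticePointsIn P Q
    · rw [(hmem u).1 hu]
    · simp [ha u hu]

/-- The difference of the two exponents is an affine relation among the points of `A`. -/
theorem eq_of_expDegree_eq {A : Set P.latticePoints}
    (hA : AffineIndependent ℝ (fun u : A => toReal u.1.1))
    {a b : P.latticePoints →₀ ℕ} (hab : expDegree P a = expDegree P b)
    (ha : ∀ u ∉ A, a u = 0) (hb : ∀ u ∉ A, b u = 0) : a = b := by
  have := Fintype.ofFinite P.latticePoints
  obtain ⟨h1, h2⟩ := real_sum_eq_of_expDegree_eq hab
  have h := (affineIndependent_subtype_iff (fun u : P.latticePoints => toReal (u : Fin m → ℤ))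
    A).1 hA (fun u => (a u : ℝ) - b u) (fun u hu => by simp [ha u hu, hb u hu])
    (by rw [Finset.sum_sub_distrib, h2, sub_self])
    (by simp only [sub_smul, Finset.sum_sub_distrib, h1, sub_self])
  ext u
  have := congrFun h u
  rw [Pi.zero_apply, sub_eq_zero] at this
  exact_mod_cast this

theorem prod_pow_eq_zero {R : Type*} [CommRing R] {A : Set P.latticePoints}
    {v : P.latticePoints → R} (hv : v ∈ coordinateSubspace R A) (a : P.latticePoints →₀ ℕ)
    (ha : ¬∀ u ∉ A, a u = 0) : (a.prod fun u n => v u ^ n) = 0 := by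
  push Not at ha
  obtain ⟨u, hu, hau⟩ := ha
  refine Finset.prod_eq_zero (Finsupp.mem_support_iff.2 hau) ?_
  dsimp only
  rw [hv u hu, zero_pow hau]

/-- All vectors supported on an affinely independent face are points of the toric variety. -/
theorem IsFace.isToricPoint {Q : Set (Fin m → ℝ)} (hQ : IsFace P Q)
    (hA : AffineIndependent ℝ (fun u : latticePointsIn P Q => toReal u.1.1))
    {R : Type*} [CommRing R] {v : P.latticePoints → R}
    (hv : v ∈ coordinateSubspace R (latticePointsIn P Q)) : IsToricPoint v := by
  intro a b hab
  by_cases ha : ∀ u ∉ latticePointsIn P Q, a u = 0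
  · rw [eq_of_expDegree_eq hA hab ha (hQ.eq_zero_of_expDegree_eq hab ha)]
  · rw [prod_pow_eq_zero hv a ha,
      prod_pow_eq_zero hv b fun hb => ha (hQ.eq_zero_of_expDegree_eq hab.symm hb)]

theorem IsFace.isToricPoint_facePoint {K : Type u} [Field K] {Q : Set (Fin m → ℝ)}
    (hQ : IsFace P Q) : IsToricPoint (facePoint K P Q) := by
  have hv : facePoint K P Q ∈ coordinateSubspace K (latticePointsIn P Q) := fun u hu => if_neg hu
  have h1 : ∀ a : P.latticePoints →₀ ℕ, (∀ u ∉ latticePointsIn P Q, a u = 0) →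
      (a.prod fun u n => facePoint K P Q u ^ n) = 1 := fun a ha => by
    refine Finset.prod_eq_one fun u hu => ?_
    have hu : u ∈ latticePointsIn P Q := by
      by_contra h
      exact Finsupp.mem_support_iff.1 hu (ha u h)
    have h : facePoint K P Q u = 1 := if_pos hu
    simp [h]
  intro a b hab
  by_cases ha : ∀ u ∉ latticePointsIn P Q, a u = 0
  · rw [h1 a ha, h1 b (hQ.eq_zero_of_expDegree_eq hab ha)]
  · rw [prod_pow_eq_zero hv a ha,
      prod_pow_eq_zero hv b fun hb => ha (hQ.eq_zero_of_expDegree_eq hab.symm hb)]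

/-- The lattice points indexing a coordinate subspace contained in the toric variety are affinely
independent. -/
theorem affineIndependent_of_isToricPoint {K : Type u} [Field K] [Infinite K]
    {A : Set P.latticePoints} (h : ∀ v ∈ coordinateSubspace K A, IsToricPoint v) :
    AffineIndependent ℝ (fun u : A => toReal u.1.1) := by
  classical
  have := Fintype.ofFinite P.latticePoints
  refine (affineIndependent_subtype_iff
    (fun u : P.latticePoints => toReal (u : Fin m → ℤ)) A).2 fun w hw h0 h1 => ?_
  obtain ⟨a, b, hab, ha, hb⟩ := exists_expDegree_eq w h0 h1
  by_contra hne
  obtain ⟨u, hu⟩ := Function.ne_iff.1 hne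
  have huA : u ∈ A := by
    by_contra h
    exact hu (hw u h)
  -- The supports of `a` and `b` are disjoint and `u` lies in one of them.
  have hne : a u ≠ b u := by
    intro h
    rcases lt_or_gt_of_ne hu with h' | h'
    · exact not_lt.2 (le_of_lt h') ((ha u).1 (h ▸ (hb u).2 h'))
    · exact not_lt.2 (le_of_lt h') ((hb u).1 (h ▸ (ha u).2 h'))
  obtain ⟨x, hx⟩ := exists_pow_ne_pow (K := K) hne
  -- The test vector is `x` at `u`, `1` on the rest of `A` and `0` elsewhere; it isolates the
  -- exponent of `u`.
  have key : ∀ a : P.latticePoints →₀ ℕ, (∀ u ∉ A, a u = 0) →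
      (a.prod fun i n => (if i = u then x else if i ∈ A then (1 : K) else 0) ^ n) = x ^ a u := by
    intro a ha
    rw [Finsupp.prod_fintype _ _ fun _ => pow_zero _, Finset.prod_eq_single u]
    · rw [if_pos rfl]
    · intro i _ hi
      rw [if_neg hi]
      by_cases hiA : i ∈ A
      · rw [if_pos hiA, one_pow]
      · rw [ha i hiA, pow_zero]
    · simp
  refine hx ?_
  rw [← key a fun u hu => ?_, ← key b fun u hu => ?_]
  · refine h _ (fun i hi => ?_) a b hab
    rw [if_neg (by rintro rfl; exact hi huA), if_neg hi]
  · by_contra h'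
    exact lt_irrefl _ (hw u hu ▸ (hb u).1 h')
  · by_contra h'
    exact lt_irrefl _ (hw u hu ▸ (ha u).1 h')

/-- The lattice points indexing a coordinate subspace contained in the toric variety are the
lattice points of a face. -/
theorem exists_isFace_of_isToricPoint {K : Type u} [Field K]
    {A : Set P.latticePoints} (hne : A.Nonempty)
    (h : ∀ v ∈ coordinateSubspace K A, IsToricPoint v) :
    ∃ Q, IsFace P Q ∧ latticePointsIn P Q = A := by
  classical
  have := Fintype.ofFinite P.latticePoints
  -- Evaluate at the indicator of `A`: a monomial is nonzero there exactly when it is supported on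
  -- `A`.
  have hsupp : ∀ a b : P.latticePoints →₀ ℕ, expDegree P a = expDegree P b →
      (∀ u ∉ A, a u = 0) → ∀ u ∉ A, b u = 0 := by
    intro a b hab ha
    by_contra hb
    have hv : (fun i => if i ∈ A then (1 : K) else 0) ∈ coordinateSubspace K A :=
      fun i hi => if_neg hi
    have h1 := h _ hv a b hab
    rw [prod_pow_eq_zero hv b hb] at h1
    refine Finset.prod_ne_zero_iff.2 (fun u hu => ?_) h1
    have hu : u ∈ A := by
      by_contra h
      exact Finsupp.mem_support_iff.1 hu (ha u h)
    simp [hu]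
  let p : P.latticePoints → Fin m → ℝ := fun u => toReal (u : Fin m → ℤ)
  have hdisj : Disjoint (convexHull ℝ (p '' Aᶜ)) (affineSpan ℝ (p '' A) : Set (Fin m → ℝ)) := by
    rw [Set.disjoint_left]
    intro x hx hx'
    obtain ⟨w, w0, wA, w1, wx⟩ := (mem_convexHull_image_iff p _ x).1 hx
    obtain ⟨w', wA', w1', wx'⟩ := exists_weights_of_mem_affineSpan_image p A x hx'
    -- Off `A` the relation `w - w'` equals `w ≥ 0`, so its negative part `b` is supported on `A`.
    -- Then so is `a`, which forces `w = 0`, contrary to total weight `1`.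
    obtain ⟨a, b, hab, ha, hb⟩ := exists_expDegree_eq (fun u => w u - w' u)
      (by rw [Finset.sum_sub_distrib, w1, w1', sub_self])
      (by
        simp only [sub_smul, Finset.sum_sub_distrib]
        exact sub_eq_zero.2 (wx.trans wx'.symm))
    have hbA : ∀ u ∉ A, b u = 0 := fun u hu => by
      by_contra h'
      have := (hb u).1 h'
      rw [wA' u hu, sub_zero] at this
      exact absurd (w0 u) (not_le.2 this)
    have haA := hsupp b a hab.symm hbA
    have : ∀ u, w u = 0 := fun u => by
      by_cases hu : u ∈ A
      · exact wA u (by simpa using hu)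
      · by_contra h'
        refine (ha u).2 ?_ (haA u hu)
        rw [wA' u hu, sub_zero]
        exact lt_of_le_of_ne (w0 u) (Ne.symm h')
    simp [this] at w1
  obtain ⟨l, r, s, hr, hrs, hs⟩ := geometric_hahn_banach_compact_closed
    (convex_convexHull ℝ (p '' Aᶜ)) ((Set.toFinite _).isCompact_convexHull ℝ)
    (affineSpan ℝ (p '' A)).convex (AffineSubspace.closed_of_finiteDimensional _) hdisj
  obtain ⟨u₀, hu₀⟩ := hne
  have hmem : ∀ u ∈ A, p u ∈ affineSpan ℝ (p '' A) := fun u hu =>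
    subset_affineSpan ℝ _ ⟨u, hu, rfl⟩
  -- A functional bounded below on an affine subspace is constant there. Otherwise the parameter
  -- below picks a point of the line where `l` equals `s`, against the strict bound.
  have hconst : ∀ u ∈ A, l (p u) = l (p u₀) := by
    intro u hu
    by_contra hne
    have h1 := hs (AffineMap.lineMap (p u₀) (p u) ((s - l (p u₀)) / (l (p u) - l (p u₀))))
      (AffineMap.lineMap_mem _ (hmem u₀ hu₀) (hmem u hu))
    rw [AffineMap.lineMap_apply_module', map_add, map_smul, map_sub, smul_eq_mul,
      div_mul_cancel₀ _ (sub_ne_zero.2 hne)] at h1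
    linarith
  have hlt : ∀ u ∉ A, l (p u) < l (p u₀) := fun u hu =>
    (hr _ (subset_convexHull ℝ _ ⟨u, hu, rfl⟩)).trans (hrs.trans (hs _ (hmem u₀ hu₀)))
  have hle : ∀ y ∈ P.carrier, l y ≤ l (p u₀) := by
    intro y hy
    rw [P.carrier_eq_convexHull] at hy
    have hconv : Convex ℝ {y | l y ≤ l (p u₀)} := convex_halfSpace_le l.isLinear _
    refine convexHull_min ?_ hconv hy
    rintro _ ⟨u, _, rfl⟩
    by_cases hu : u ∈ A
    · exact (hconst u hu).le
    · exact (hlt u hu).le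
  refine ⟨_, isFace_of_functional hle ⟨p u₀, u₀.2, rfl⟩, ?_⟩
  ext u
  constructor
  · rintro ⟨_, hu⟩
    by_contra hA
    exact (hlt u hA).ne hu
  · exact fun hu => ⟨u.2, hconst u hu⟩

end Face

/-! ### Closures of torus orbits -/

section Orbit

variable {K : Type u} [Field K] {m : ℕ} {P : LatticePolytope m} {Q : Set (Fin m → ℝ)}

theorem facePoint_mem_coordinateSubspace :
    facePoint K P Q ∈ coordinateSubspace K (latticePointsIn P Q) := fun _ hu => if_neg hu

theorem facePoint_of_mem {u : P.latticePoints} (hu : u ∈ latticePointsIn P Q) :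
    facePoint K P Q u = 1 := if_pos hu

theorem exists_rep_eq_of_mem_faceOrbit {p : Projectivization K (P.latticePoints → K)}
    (hp : p ∈ faceOrbit K P Q) :
    ∃ (t : Torus m K) (c : K), p.rep = c • torusEquiv P t (facePoint K P Q) := by
  obtain ⟨t, ht⟩ := hp
  have h : p.rep ∈ p.submodule := by
    rw [Projectivization.submodule_eq]
    exact Submodule.mem_span_singleton_self _
  rw [ht, Submodule.mem_span_singleton] at h
  obtain ⟨c, hc⟩ := h
  exact ⟨t, c, hc.symm⟩

theorem faceOrbit_subset_faceVariety : faceOrbit K P Q ⊆ faceVariety K P Q :=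
  fun p hp _ _ _ hf => hf p hp

theorem IsFace.exists_mem_faceOrbit (hQ : IsFace P Q) (t : Torus m K) :
    ∃ p ∈ faceOrbit K P Q, p.submodule =
      Submodule.span K {torusEquiv P t (facePoint K P Q)} := by
  obtain ⟨u, hu⟩ := hQ.latticePointsIn_nonempty
  have h0 : torusEquiv P t (facePoint K P Q) ≠ 0 := fun h => by
    have := congrFun h u
    rw [torusEquiv_apply, facePoint_of_mem hu] at this
    simp at this
  exact ⟨Projectivization.mk K _ h0, ⟨t, Projectivization.submodule_mk _ _⟩,
    Projectivization.submodule_mk _ _⟩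

theorem faceVariety_subset_linearSubspace :
    faceVariety K P Q ⊆ linearSubspace (coordinateSubspace K (latticePointsIn P Q)) := by
  intro p hp
  rw [mem_linearSubspace_iff]
  intro u hu
  have h := hp 1 (MvPolynomial.X u) (MvPolynomial.isHomogeneous_X K u) fun q hq => by
    obtain ⟨t, c, h⟩ := exists_rep_eq_of_mem_faceOrbit hq
    rw [MvPolynomial.eval_X, h, Pi.smul_apply,
      torusEquiv_mem_coordinateSubspace t facePoint_mem_coordinateSubspace u hu, smul_zero]
  rwa [MvPolynomial.eval_X] at h

/-- The binomials `x^a - x^b` of equal degree in `S_P` are homogeneous, because that degree records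
the total exponent, and they vanish on the orbit. -/
theorem IsFace.isToricPoint_rep (hQ : IsFace P Q) {p : Projectivization K (P.latticePoints → K)}
    (hp : p ∈ faceVariety K P Q) : IsToricPoint p.rep := by
  have := Fintype.ofFinite P.latticePoints
  intro a b hab
  have hdeg : Finsupp.degree b = Finsupp.degree a := by
    rw [Finsupp.degree_eq_sum, Finsupp.degree_eq_sum, ((expDegree_eq_iff a b).1 hab).2]
  have h := hp (Finsupp.degree a) (MvPolynomial.monomial a 1 - MvPolynomial.monomial b 1)
    ((MvPolynomial.isHomogeneous_monomial _ rfl).sub (MvPolynomial.isHomogeneous_monomial _ hdeg))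
    fun q hq => by
      obtain ⟨t, c, h⟩ := exists_rep_eq_of_mem_faceOrbit hq
      have hq : IsToricPoint q.rep := by
        rw [h]
        exact (isToricPoint_const c).mul
          ((isToricPoint_character t).mul hQ.isToricPoint_facePoint)
      simpa [MvPolynomial.eval_monomial, sub_eq_zero] using hq a b hab
  simpa [MvPolynomial.eval_monomial, sub_eq_zero] using h

theorem degree_of_mem_support {ι : Type*} {f : MvPolynomial ι K} {d : ℕ}
    (hf : f.IsHomogeneous d) {a : ι →₀ ℕ} (ha : a ∈ f.support) : Finsupp.degree a = d := by
  rw [Finsupp.degree_eq_weight_one]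
  exact hf (MvPolynomial.mem_support_iff.1 ha)

theorem eval_smul_of_isHomogeneous {ι : Type*} {f : MvPolynomial ι K} {d : ℕ}
    (hf : f.IsHomogeneous d) (c : K) (v : ι → K) :
    MvPolynomial.eval (c • v) f = c ^ d * MvPolynomial.eval v f := by
  rw [MvPolynomial.eval_eq, MvPolynomial.eval_eq, Finset.mul_sum]
  refine Finset.sum_congr rfl fun a ha => ?_
  simp only [Pi.smul_apply, smul_eq_mul, mul_pow, Finset.prod_mul_distrib,
    Finset.prod_pow_eq_pow_sum]
  rw [show ∑ i ∈ a.support, a i = d from degree_of_mem_support hf ha]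
  ring

theorem linearSubspace_subset_faceVariety [Infinite K] (hQ : IsFace P Q)
    (hA : AffineIndependent ℝ (fun u : latticePointsIn P Q => toReal u.1.1)) :
    linearSubspace (coordinateSubspace K (latticePointsIn P Q)) ⊆ faceVariety K P Q := by
  classical
  have := Fintype.ofFinite P.latticePoints
  intro p hp d f hf hfQ
  rw [mem_linearSubspace_iff] at hp
  -- On this subspace only the monomials supported on `Q` survive. Along the orbit they become
  -- characters, distinct by affine independence since all have total degree `d`; hence their
  -- coefficients vanish.
  have hev : ∀ v ∈ coordinateSubspace K (latticePointsIn P Q), MvPolynomial.eval v f =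
      ∑ a ∈ f.support with ∀ u ∉ latticePointsIn P Q, a u = 0,
        MvPolynomial.coeff a f * a.prod fun u n => v u ^ n := fun v hv => by
    rw [MvPolynomial.eval_eq]
    refine (Finset.sum_subset (Finset.filter_subset _ _) fun a ha ha' => ?_).symm
    rw [show ∏ i ∈ a.support, v i ^ a i = 0 from
      prod_pow_eq_zero hv a fun h => ha' (Finset.mem_filter.2 ⟨ha, h⟩), mul_zero]
  have hcoeff := eq_zero_of_sum_character (K := K)
    {a ∈ f.support | ∀ u ∉ latticePointsIn P Q, a u = 0}
    (fun a => ∑ u, a u • (u : Fin m → ℤ)) (fun a ha b hb hab => ?_)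
    (fun a => MvPolynomial.coeff a f) (fun t => ?_)
  · rw [hev _ hp]
    exact Finset.sum_eq_zero fun a ha => by rw [hcoeff a ha, zero_mul]
  · simp only [Finset.coe_filter, Set.mem_ofPred_eq] at ha hb
    refine eq_of_expDegree_eq hA ((expDegree_eq_iff a b).2 ⟨hab, ?_⟩) ha.2 hb.2
    rw [← Finsupp.degree_eq_sum, ← Finsupp.degree_eq_sum]
    exact (degree_of_mem_support hf ha.1).trans (degree_of_mem_support hf hb.1).symm
  · obtain ⟨q, hq, hqt⟩ := hQ.exists_mem_faceOrbit (K := K) t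
    have h : torusEquiv P t (facePoint K P Q) ∈ q.submodule := by
      rw [hqt]
      exact Submodule.mem_span_singleton_self _
    rw [Projectivization.submodule_eq, Submodule.mem_span_singleton] at h
    obtain ⟨c, hc⟩ := h
    have h0 : MvPolynomial.eval (torusEquiv P t (facePoint K P Q)) f = 0 := by
      rw [← hc, eval_smul_of_isHomogeneous hf, hfQ q hq, mul_zero]
    rw [hev _ (torusEquiv_mem_coordinateSubspace t facePoint_mem_coordinateSubspace)] at h0
    rw [← h0]
    refine Finset.sum_congr rfl fun a ha => ?_
    rw [← prod_character]
    congr 1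
    refine Finset.prod_congr rfl fun u hu => ?_
    have hu : u ∈ latticePointsIn P Q := by
      by_contra h
      exact Finsupp.mem_support_iff.1 hu ((Finset.mem_filter.1 ha).2 u h)
    simp only [torusEquiv_apply, facePoint_of_mem hu, mul_one]

/-- The orbit closure of an affinely independent face is a coordinate subspace. -/
theorem IsFace.faceVariety_eq [Infinite K] (hQ : IsFace P Q)
    (hA : AffineIndependent ℝ (fun u : latticePointsIn P Q => toReal u.1.1)) :
    faceVariety K P Q = linearSubspace (coordinateSubspace K (latticePointsIn P Q)) :=
  faceVariety_subset_linearSubspace.antisymm (linearSubspace_subset_faceVariety hQ hA)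

/-- `W` contains the orbit of the face point, hence by independence of characters every coordinate
vector of `Q`. -/
theorem IsFace.eq_coordinateSubspace [Infinite K] (hQ : IsFace P Q)
    {W : Submodule K (P.latticePoints → K)} (hW : faceVariety K P Q = linearSubspace W) :
    W = coordinateSubspace K (latticePointsIn P Q) := by
  classical
  refine le_antisymm (linearSubspace_subset_iff.1 (hW ▸ faceVariety_subset_linearSubspace)) ?_
  have ht : ∀ t : Torus m K, torusEquiv P t (facePoint K P Q) ∈ W := fun t => by
    obtain ⟨q, hq, hqt⟩ := hQ.exists_mem_faceOrbit (K := K) t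
    have h : q ∈ linearSubspace W := hW ▸ faceOrbit_subset_faceVariety hq
    have h' : q.submodule ≤ W := h
    rwa [hqt, Submodule.span_singleton_le_iff_mem] at h'
  refine fun v hv => mem_of_single_mem _ _ fun u => ?_
  by_cases hu : u ∈ latticePointsIn P Q
  · have h := single_mem_of_torusEquiv_mem W _ ht u
    rw [facePoint_of_mem hu] at h
    exact single_mem_of_single_ne_zero W _ one_ne_zero h
  · rw [hv u hu, Pi.single_zero]
    exact W.zero_mem

theorem IsFace.affineIndependent_of_faceVariety_eq [Infinite K] (hQ : IsFace P Q)
    {W : Submodule K (P.latticePoints → K)} (hW : faceVariety K P Q = linearSubspace W) :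
    AffineIndependent ℝ (fun u : latticePointsIn P Q => toReal u.1.1) := by
  refine affineIndependent_of_isToricPoint (K := K) fun v hv => ?_
  by_cases h0 : v = 0
  · rw [h0]
    exact isToricPoint_const 0
  have hp : Projectivization.mk K v h0 ∈ faceVariety K P Q := by
    rw [hW, hQ.eq_coordinateSubspace hW]
    simpa [linearSubspace, Projectivization.submodule_mk] using hv
  obtain ⟨c, hc⟩ := Projectivization.exists_smul_eq_mk_rep K v h0
  -- The chosen representative differs from `v` by a unit, and scaling preserves toric points.
  have h1 : v = (fun _ => ((c⁻¹ : Kˣ) : K)) * (Projectivization.mk K v h0).rep := by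
    rw [← hc]
    ext u
    simp [Units.smul_def]
  rw [h1]
  exact (isToricPoint_const _).mul (hQ.isToricPoint_rep hp)

end Orbit

/-! ### Fixed points of the Fano scheme -/

section FixedPoint

variable {K : Type u} [Field K] {m : ℕ} {P : LatticePolytope m} {k : ℕ}

/-- The `K`-point of the Fano scheme given by a coordinate subspace contained in `X_P`. -/
def coordinateFanoPoint (k : ℕ) (A : Set P.latticePoints) (hcard : A.ncard = k + 1)
    (h : ∀ (S : Type u) [CommRing S] [Algebra K S], ∀ v ∈ coordinateSubspace S A,
      IsToricPoint v) : FanoPoint (toricIdeal K P) k K where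
  toSubmodule := coordinateSubspace K A
  isComplemented := ⟨_, isCompl_coordinateSubspace K A⟩
  rank_eq p := by
    rw [Module.rankAtStalk_eq_finrank_of_free, finrank_coordinateSubspace, hcard]
    rfl
  vanishing S _ _ φ v hv := by
    rw [baseChange_coordinateSubspace] at hv
    exact (isToricPoint_iff v).1 (h S v hv)

theorem coordinateFanoPoint_mem_fixedPoints (A : Set P.latticePoints) (hcard : A.ncard = k + 1)
    (h : ∀ (S : Type u) [CommRing S] [Algebra K S], ∀ v ∈ coordinateSubspace S A,
      IsToricPoint v) : coordinateFanoPoint k A hcard h ∈ fixedPoints K P k := by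
  intro R _ _ t
  refine FanoPoint.ext ?_
  change (baseChange _ (coordinateSubspace K A)).map _ = baseChange _ (coordinateSubspace K A)
  rw [baseChange_coordinateSubspace, map_torusEquiv_coordinateSubspace]

/-- Invariance under the `K`-points of `T` alone already makes the plane a coordinate subspace; the
toric condition then supplies the face and its affine independence. -/
theorem exists_isFace_of_mem_fixedPoints [Infinite K] {x : FanoPoint (toricIdeal K P) k K}
    (hx : x ∈ fixedPoints K P k) : ∃ Q, IsFace P Q ∧ IsPrimitiveSimplex k Q ∧
      x.toSubmodule = coordinateSubspace K (latticePointsIn P Q) := by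
  have hmap : ∀ t : Torus m K, x.toSubmodule.map (torusEquiv P t).toLinearMap =
      x.toSubmodule := fun t => by
    have h : (baseChange (algebraMap K K) x.toSubmodule).map (torusEquiv P t).toLinearMap =
      baseChange (algebraMap K K) x.toSubmodule := congrArg FanoPoint.toSubmodule (hx K t)
    rwa [Algebra.algebraMap_self, baseChange_id] at h
  obtain ⟨A, hA⟩ := eq_coordinateSubspace_of_torusEquiv_mem x.toSubmodule fun t v hv => by
    rw [← hmap t]
    exact ⟨v, hv, rfl⟩
  have hcard : A.ncard = k + 1 := by
    have h := x.rank_eq ⊥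
    rw [hA, Module.rankAtStalk_eq_finrank_of_free, finrank_coordinateSubspace] at h
    exact h
  have htoric : ∀ v ∈ coordinateSubspace K A, IsToricPoint v := fun v hv => by
    refine (isToricPoint_iff (K := K) v).2 (x.vanishing K (AlgHom.id K K) v ?_)
    rw [hA, baseChange_coordinateSubspace]
    exact hv
  -- The rank `k + 1` is never zero, so `A` can index a nonempty face.
  have hne : A.Nonempty := Set.nonempty_of_ncard_ne_zero (by omega)
  obtain ⟨Q, hQ, rfl⟩ := exists_isFace_of_isToricPoint hne htoric
  exact ⟨Q, hQ, (hQ.isPrimitiveSimplex_iff k).2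
    ⟨affineIndependent_of_isToricPoint htoric, hcard⟩, hA⟩

end FixedPoint

end ToricFano

/-! ### Fixed points of the Fano scheme and linear orbit closures -/

theorem mainTheorem3 {K : Type u} [Field K] [IsAlgClosed K] {m : ℕ}
    (P : ToricFano.LatticePolytope m) (k : ℕ) :
    (∃ e : {Q : Set (Fin m → ℝ) // ToricFano.IsFace P Q ∧ ToricFano.IsPrimitiveSimplex k Q} ≃
        ToricFano.fixedPoints K P k,
      ∀ Q, ToricFano.linearSubspace (e Q).1.toSubmodule = ToricFano.faceVariety K P Q.1) ∧
    ∀ Q : Set (Fin m → ℝ), ToricFano.IsFace P Q →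
      ((∃ W : Submodule K (P.latticePoints → K),
          ToricFano.faceVariety K P Q = ToricFano.linearSubspace W) ↔
        ∃ d, ToricFano.IsPrimitiveSimplex d Q) ∧
      ∀ d : ℕ, (∃ W : Submodule K (P.latticePoints → K), Module.finrank K W = d + 1 ∧
          ToricFano.faceVariety K P Q = ToricFano.linearSubspace W) ↔
        ToricFano.IsPrimitiveSimplex d Q := by
  open ToricFano in
  have : Infinite K := IsAlgClosed.instInfinite
  refine ⟨?_, fun Q hQ => ?_⟩
  · let F : {Q : Set (Fin m → ℝ) // IsFace P Q ∧ IsPrimitiveSimplex k Q} → fixedPoints K P k :=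
      fun Q => ⟨_, coordinateFanoPoint_mem_fixedPoints (latticePointsIn P Q.1)
        ((Q.2.1.isPrimitiveSimplex_iff k).1 Q.2.2).2 fun S _ _ v hv =>
          Q.2.1.isToricPoint ((Q.2.1.isPrimitiveSimplex_iff k).1 Q.2.2).1 hv⟩
    have hF : ∀ Q, FanoPoint.toSubmodule (F Q).1 = coordinateSubspace K (latticePointsIn P Q.1) :=
      fun _ => rfl
    refine ⟨Equiv.ofBijective F ⟨fun Q Q' h => ?_, fun x => ?_⟩, fun Q => ?_⟩
    · have h1 : latticePointsIn P Q.1 = latticePointsIn P Q'.1 :=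
        coordinateSubspace_injective K (by rw [← hF, ← hF, h])
      apply Subtype.ext
      -- A face is recovered from its lattice points as their convex hull.
      rw [Q.2.1.eq_convexHull, Q'.2.1.eq_convexHull, h1]
    · obtain ⟨Q, hQ, hQk, hx⟩ := exists_isFace_of_mem_fixedPoints x.2
      exact ⟨⟨Q, hQ, hQk⟩, Subtype.ext (FanoPoint.ext hx.symm)⟩
    · exact (Q.2.1.faceVariety_eq ((Q.2.1.isPrimitiveSimplex_iff k).1 Q.2.2).1).symm
  · have key : ∀ d : ℕ, (∃ W : Submodule K (P.latticePoints → K), Module.finrank K W = d + 1 ∧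
        faceVariety K P Q = linearSubspace W) ↔ IsPrimitiveSimplex d Q := by
      intro d
      rw [hQ.isPrimitiveSimplex_iff]
      constructor
      · rintro ⟨W, hd, hW⟩
        refine ⟨hQ.affineIndependent_of_faceVariety_eq hW, ?_⟩
        rw [← finrank_coordinateSubspace K, ← hQ.eq_coordinateSubspace hW, hd]
      · rintro ⟨hA, hcard⟩
        exact ⟨_, (finrank_coordinateSubspace K _).trans hcard, hQ.faceVariety_eq hA⟩
    refine ⟨⟨fun ⟨W, hW⟩ => ?_, fun ⟨d, hd⟩ => ?_⟩, key⟩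
    · have hpos := hQ.latticePointsIn_nonempty.ncard_pos (Set.toFinite _)
      exact ⟨(latticePointsIn P Q).ncard - 1, (hQ.isPrimitiveSimplex_iff _).2
        ⟨hQ.affineIndependent_of_faceVariety_eq hW, by omega⟩⟩
    · obtain ⟨W, _, hW⟩ := (key d).2 hd
      exact ⟨W, hW⟩
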